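/- **Conventions on polytopes.** Let $Q\subset\mathbb{R}^d$ be a polytope (the convex hull of a finite set). Its faces are the nonempty sets of maximizers over $Q$ of linear functionals ($Q$ itself included), $f_i$ is the number of $i$-dimensional faces, and the $h$-vector $(h_0,\dots,h_d)$ is defined by $\sum_{i=0}^d f_i(x-1)^i=\sum_{k=0}^d h_kx^k$ (with $h_k=0$ for $k>d$). A cost vector $c\in\mathbb{R}^d$ is *generic* for $Q$ if it is not orthogonal to any edge of $Q$; then $G_c(Q)$ is the 1-skeleton of $Q$ with each edge oriented in the direction of increasing inner product with $c$. $Q$ is *directionally simple* with respect to the generic vector $c$ if for every vertex $v$ and every set $E$ of edges of $G_c(Q)$ with source $v$ there is a face $F$ of $Q$ containing $v$ whose set of edges incident to $v$ is exactly $E$. **(1)** If $Q\subset\mathbb{R}^d$ is directionally simple with respect to the generic cost vector $c$, then for all $k=0,\dots,d$ the number $h_k$ equals the number of vertices of $Q$ with out-degree exactly $k$ in $G_c(Q)$. **Conventions on permutations.** Let $\ell$ be the Coxeter length on $S_n$ with respect to the adjacent transpositions $s_i=(i\ i{+}1)$. Right weak order $\le_R$ has cover relations $u\lessdot us_i$ with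 $\ell(us_i)=\ell(u)+1$, and Bruhat order $\preceq$ has cover relations $u\lessdot ut$ with $t$ a transposition and $\ell(ut)=\ell(u)+1$; $[e,w]=\{u: u\preceq w\}$. Write $\mathrm{asc}(u)=n-1-|\{i:\ell(us_i)<\ell(u)\}|$ for the number of right ascents of $u$ (read as $0$ if $n=0$). Let $\boldsymbol{u}=(u^{-1}(1),\dots,u^{-1}(n))$ and let $Q_w=\mathrm{conv}\{\boldsymbol{u}: u\preceq w\}\subset\mathbb{R}^n$ be the Bruhat interval polytope. For $y\in S_n$ let $C(y)$ be the closed cone of vectors whose coordinates are weakly in the same relative order as those of $\boldsymbol{y}$, and for $u\preceq w$ let $C_w(u)$ be the cone of all $a\in\mathbb{R}^n$ such that $\langle a,\cdot\rangle$ attains its maximum over $Q_w$ at $\boldsymbol{u}$. For $x\in S_n$ let $[x]_w$ be the set of $y\in S_n$ such that $C(x)$ and $C(y)$ are contained in a common cone $C_w(u)$ with $u\preceq w$. **(2)** Let $w\in S_n$. Each class $[x]_w$, $x\in S_n$, has a (unique) maximum $\mathrm{Top}_w(x)$ in right weak order, and the $h$-vector of $Q_w$ satisfies, for all $k\ge 0$,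 $$h_k=\left|\{z\in \mathrm{Top}_w([e,w]) : \mathrm{asc}(z)=k\}\right|.$$ -/

import Mathlib

namespace BruhatPolytope

noncomputable section

/-! ### Polytopes, faces, `f`-vector and `h`-vector -/

/-- A (convex) polytope in `ℝ^d`: the convex hull of a finite set of points. -/
def IsPolytope {d : ℕ} (Q : Set (EuclideanSpace ℝ (Fin d))) : Prop :=
  ∃ s : Finset (EuclideanSpace ℝ (Fin d)), Q = convexHull ℝ (s : Set (EuclideanSpace ℝ (Fin d)))

/-- A (nonempty) face of `Q`: the set of all maximizers over `Q` of some linear functional. The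
zero functional shows that a nonempty `Q` is a face of itself. -/
def IsFace {d : ℕ} (Q F : Set (EuclideanSpace ℝ (Fin d))) : Prop :=
  F.Nonempty ∧ IsExposed ℝ Q F

/-- The dimension of a (nonempty) face: the dimension of its affine hull. -/
def faceDim {d : ℕ} (F : Set (EuclideanSpace ℝ (Fin d))) : ℕ :=
  Module.finrank ℝ (vectorSpan ℝ F)

/-- `v` is a vertex of `Q`. -/
def IsVertex {d : ℕ} (Q : Set (EuclideanSpace ℝ (Fin d))) (v : EuclideanSpace ℝ (Fin d)) : Prop :=
  IsFace Q {v}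

/-- `e` is an edge of `Q`, that is, a one-dimensional face. -/
def IsEdge {d : ℕ} (Q e : Set (EuclideanSpace ℝ (Fin d))) : Prop :=
  IsFace Q e ∧ faceDim e = 1

/-- `f_i`, the number of `i`-dimensional faces of `Q`. -/
def fVector {d : ℕ} (Q : Set (EuclideanSpace ℝ (Fin d))) (i : ℕ) : ℕ :=
  {F : Set (EuclideanSpace ℝ (Fin d)) | IsFace Q F ∧ faceDim F = i}.ncard

/-- `h_k`, the coefficient of `x ^ k` in `∑_{i = 0}^{d} f_i (x - 1) ^ i`. -/
def hVector {d : ℕ} (Q : Set (EuclideanSpace ℝ (Fin d))) (k : ℕ) : ℤ :=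
  (∑ i ∈ Finset.range (d + 1),
    Polynomial.C (fVector Q i : ℤ) * (Polynomial.X - 1) ^ i).coeff k

/-! ### Directionally simple polytopes -/

/-- The cost vector `c` is generic: it is not orthogonal to any edge of `Q`. -/
def IsGeneric {d : ℕ} (Q : Set (EuclideanSpace ℝ (Fin d))) (c : EuclideanSpace ℝ (Fin d)) : Prop :=
  ∀ e, IsEdge Q e → ∃ x ∈ e, ∃ y ∈ e, inner ℝ c (y - x) ≠ 0

/-- The edges of the directed graph `G_c(Q)` with source `v`: the edges of `Q` at `v` along
which the inner product with `c` increases away from `v`. -/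
def outEdges {d : ℕ} (Q : Set (EuclideanSpace ℝ (Fin d))) (c v : EuclideanSpace ℝ (Fin d)) :
    Set (Set (EuclideanSpace ℝ (Fin d))) :=
  {e | IsEdge Q e ∧ v ∈ e ∧ ∀ x ∈ e, x ≠ v → inner ℝ c v < inner ℝ c x}

/-- `Q` is directionally simple with respect to `c`: for every vertex `v` and every set `E` of
edges of `G_c(Q)` with source `v` there is a face `F` of `Q` containing `v` such that the edges of
`F` at `v` are exactly the elements of `E`. -/
def IsDirectionallySimple {d : ℕ} (Q : Set (EuclideanSpace ℝ (Fin d)))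
    (c : EuclideanSpace ℝ (Fin d)) : Prop :=
  ∀ v, IsVertex Q v → ∀ E ⊆ outEdges Q c v,
    ∃ F, IsFace Q F ∧ v ∈ F ∧ {e | IsEdge Q e ∧ v ∈ e ∧ e ⊆ F} = E

/-! ### The symmetric group: length, weak order, Bruhat order, ascents -/

/-- `s` is one of the adjacent transpositions `s_i = (i i+1)`. -/
def IsSimpleReflection {n : ℕ} (s : Equiv.Perm (Fin n)) : Prop :=
  ∃ i j : Fin n, (i : ℕ) + 1 = (j : ℕ) ∧ s = Equiv.swap i j

/-- Coxeter length: the least length of a word in the adjacent transpositions with product `w`. -/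
def length {n : ℕ} (w : Equiv.Perm (Fin n)) : ℕ :=
  sInf {m | ∃ l : List (Equiv.Perm (Fin n)),
    l.length = m ∧ (∀ s ∈ l, IsSimpleReflection s) ∧ l.prod = w}

/-- Right weak order, with cover relations `u ⋖ u s`, `s` simple, `ℓ(us) = ℓ(u) + 1`. -/
def weakLE {n : ℕ} : Equiv.Perm (Fin n) → Equiv.Perm (Fin n) → Prop :=
  Relation.ReflTransGen fun u v =>
    ∃ s, IsSimpleReflection s ∧ v = u * s ∧ length v = length u + 1

/-- (Strong) Bruhat order, with cover relations `u ⋖ u t`, `t` a transposition,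
`ℓ(ut) = ℓ(u) + 1`. -/
def bruhatLE {n : ℕ} : Equiv.Perm (Fin n) → Equiv.Perm (Fin n) → Prop :=
  Relation.ReflTransGen fun u v =>
    ∃ t : Equiv.Perm (Fin n), t.IsSwap ∧ v = u * t ∧ length v = length u + 1

/-- The lower Bruhat interval `[e, w]`. -/
def lowerInterval {n : ℕ} (w : Equiv.Perm (Fin n)) : Set (Equiv.Perm (Fin n)) :=
  {u | bruhatLE u w}

/-- The right descents `D_R(u)`: the simple reflections `s` with `ℓ(us) < ℓ(u)`. -/
def rightDescents {n : ℕ} (u : Equiv.Perm (Fin n)) : Set (Equiv.Perm (Fin n)) :=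
  {s | IsSimpleReflection s ∧ length (u * s) < length u}

/-- The number of right ascents of `u`: the `n - 1` simple reflections, minus the descents. -/
def asc {n : ℕ} (u : Equiv.Perm (Fin n)) : ℕ :=
  n - 1 - (rightDescents u).ncard

/-! ### Bruhat interval polytopes and the map `Top_w` -/

/-- The vector `(w⁻¹(1), …, w⁻¹(n))`. (The index type `Fin n` starts at `0`.) -/
def permVec {n : ℕ} (w : Equiv.Perm (Fin n)) : EuclideanSpace ℝ (Fin n) :=
  WithLp.toLp 2 fun i => (((w⁻¹ i : Fin n) : ℕ) : ℝ) + 1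

/-- The Bruhat interval polytope `Q_w`. -/
def bruhatIntervalPolytope {n : ℕ} (w : Equiv.Perm (Fin n)) : Set (EuclideanSpace ℝ (Fin n)) :=
  convexHull ℝ (permVec '' lowerInterval w)

/-- The top-dimensional (closed) cone `C(y)` of the braid fan: the vectors whose coordinates are
weakly in the same relative order as those of the vector of `y`. -/
def braidCone {n : ℕ} (y : Equiv.Perm (Fin n)) : Set (EuclideanSpace ℝ (Fin n)) :=
  {a | ∀ i j, permVec y i < permVec y j → a i ≤ a j}

/-- The normal cone `C_w(u)` of `Q_w` at (the vector of) `u`: the functionals that attain their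
maximum over `Q_w` there. -/
def normalCone {n : ℕ} (w u : Equiv.Perm (Fin n)) : Set (EuclideanSpace ℝ (Fin n)) :=
  {a | ∀ x ∈ bruhatIntervalPolytope w, inner ℝ a x ≤ inner ℝ a (permVec u)}

/-- The class `[x]_w`: those `y` for which the cones `C(x)` and `C(y)` lie in a common
top-dimensional cone `C_w(u)`, `u ∈ [e, w]`, of the normal fan of `Q_w`. -/
def fanClass {n : ℕ} (w x : Equiv.Perm (Fin n)) : Set (Equiv.Perm (Fin n)) :=
  {y | ∃ u ∈ lowerInterval w, braidCone x ⊆ normalCone w u ∧ braidCone y ⊆ normalCone w u}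

/-- `z` is the maximum of the class `[x]_w` in right weak order. -/
def IsTop {n : ℕ} (w x z : Equiv.Perm (Fin n)) : Prop :=
  z ∈ fanClass w x ∧ ∀ y ∈ fanClass w x, weakLE y z

/-- `Top_w(x)`, the maximum of the class `[x]_w` in right weak order. -/
def Top {n : ℕ} (w x : Equiv.Perm (Fin n)) : Equiv.Perm (Fin n) :=
  Classical.epsilon (IsTop w x)

end

end BruhatPolytope

/-! Part (1). For a generic cost every face has a unique lowest vertex `v`, its source, and all its
edges at `v` leave `v`. A polytope lies in the cone spanned by its edges at a vertex
(`IsVertex.exists_edge_cone`), so a face is determined by its edges at any one of its vertices.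
Directional simplicity makes every set `E` of out-edges at `v` the set of edges at `v` of some face,
and forces the directions in `E` to be linearly independent, so that face has dimension `|E|`
(`faceDim_eq_ncard`). Faces with source `v` thus correspond to subsets of the out-edges at `v`, and
`∑ f_i (x-1)^i = ∑_v ∑_E (x-1)^|E| = ∑_v x^outdeg(v)`.

Part (2). To each `u ≤ w` belongs a partial order `P` on the coordinates (`FanPoset`) such that
`C_w(u)` is the cone of weakly `P`-monotone vectors; the classes `[x]_w` are then the sets of linear
extensions of these orders. The orders are built by induction on `ℓ(w)`. If `s = (k k')` is an
adjacent transposition with `sw > w`, then `[e, sw] = [e, w] ∪ s[e, w]`. A vertex `u ≤ w` with `k`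
before `k'` gets the relation `k < k'` adjoined to its order (`FanPoset.addRel`), and `su` gets the
image of the enlarged order under `s` (`FanPoset.swap_mul`).

The induction carries combinatorial axioms with two consequences. First, `P` has a linear extension
`z` inverting every pair it can, and `z` is the weak order maximum of the class. Second, the covers
`p ⋖ q` of `P` with `p < q` are exactly the pairs at ascents of `z`. Edges of `Q_w` at `u` lead to
vertices `(p q)u` with `p ⋖ q` in `P`, and the cost `-(1, …, n)` increases along such an edge
exactly when `p < q`. So the out-edges at `u` are in bijection with the ascents of `Top_w(u)`. A
functional nondecreasing along `z`, with ties across a chosen set of ascents only, exposes a face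
with exactly the chosen edges at `u`. Hence `Q_w` is directionally simple, part (1) applies, and
injectivity of `Top_w` on `[e, w]` converts the count of vertices into a count of permutations. -/

open Finset in
theorem exists_minimal_finset {α : Type*} (p : Finset α → Prop) (s : Finset α) (hs : p s) :
    ∃ t ⊆ s, p t ∧ ∀ u, u ⊂ t → ¬ p u := by
  induction s using Finset.strongInduction with
  | H s ih =>
    by_cases h : ∀ u, u ⊂ s → ¬ p u
    · exact ⟨s, subset_rfl, hs, h⟩
    · push Not at h
      obtain ⟨u, hu, hpu⟩ := h
      obtain ⟨t, ht, h1, h2⟩ := ih u hu hpu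
      exact ⟨t, ht.trans hu.subset, h1, h2⟩

namespace BruhatPolytope

/-! ### Faces of polytopes -/

section Faces

variable {d : ℕ} {Q F G : Set (EuclideanSpace ℝ (Fin d))} {v p : EuclideanSpace ℝ (Fin d)}

theorem IsFace.exists_functional (h : IsFace Q F) :
    ∃ l : StrongDual ℝ (EuclideanSpace ℝ (Fin d)), F = {x ∈ Q | ∀ y ∈ Q, l y ≤ l x} :=
  h.2 h.1

theorem IsFace.subset (h : IsFace Q F) : F ⊆ Q := IsExposed.subset (𝕜 := ℝ) h.2

theorem isFace_of_functional (l : StrongDual ℝ (EuclideanSpace ℝ (Fin d))) (hv : v ∈ Q)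
    (hmax : ∀ y ∈ Q, l y ≤ l v) : IsFace Q {x ∈ Q | l x = l v} := by
  refine ⟨⟨v, hv, rfl⟩, fun _ => ⟨l, ?_⟩⟩
  ext x
  constructor
  · rintro ⟨hx, h⟩
    exact ⟨hx, fun y hy => h ▸ hmax y hy⟩
  · rintro ⟨hx, h⟩
    exact ⟨hx, le_antisymm (hmax x hx) (h v hv)⟩

/-- A functional exposing a face, normalized at a point of the face. -/
theorem IsFace.exists_functional_at (h : IsFace Q F) (hv : v ∈ F) :
    ∃ l : StrongDual ℝ (EuclideanSpace ℝ (Fin d)),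
      (∀ y ∈ Q, l y ≤ l v) ∧ ∀ x, x ∈ F ↔ x ∈ Q ∧ l x = l v := by
  obtain ⟨l, rfl⟩ := h.exists_functional
  refine ⟨l, hv.2, fun x => ⟨fun hx => ⟨hx.1, le_antisymm (hv.2 x hx.1) (hx.2 v hv.1)⟩, ?_⟩⟩
  rintro ⟨hx, h⟩
  exact ⟨hx, fun y hy => h ▸ hv.2 y hy⟩

theorem IsFace.of_subset (hF : IsFace Q F) (hG : IsFace Q G) (h : G ⊆ F) : IsFace F G :=
  ⟨hG.1, IsExposed.mono (𝕜 := ℝ) hG.2 hF.subset h⟩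

/-- By Krein–Milman the face is the closed hull of its extreme points. These are extreme in the
whole polytope, hence lie in `V`. -/
theorem IsFace.eq_convexHull {V : Set (EuclideanSpace ℝ (Fin d))} (hV : V.Finite)
    (hF : IsFace (convexHull ℝ V) F) : F = convexHull ℝ (V ∩ F) := by
  have hconv : Convex ℝ F := IsExposed.convex (𝕜 := ℝ) hF.2 (convex_convexHull ℝ V)
  have hcomp : IsCompact F := IsExposed.isCompact (𝕜 := ℝ) hF.2 (hV.isCompact_convexHull (𝕜 := ℝ))
  refine subset_antisymm ?_ (convexHull_min Set.inter_subset_right hconv)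
  have h1 := closure_convexHull_extremePoints hcomp hconv
  have h2 : F.extremePoints ℝ ⊆ V ∩ F := fun x hx =>
    ⟨extremePoints_convexHull_subset ((IsExposed.isExtreme (𝕜 := ℝ) hF.2).extremePoints_subset_extremePoints hx), hx.1⟩
  have hfin : (V ∩ F).Finite := hV.subset Set.inter_subset_left
  calc F = closure (convexHull ℝ (F.extremePoints ℝ)) := h1.symm
    _ ⊆ closure (convexHull ℝ (V ∩ F)) := closure_mono (convexHull_mono h2)
    _ = convexHull ℝ (V ∩ F) := (hfin.isClosed_convexHull (𝕜 := ℝ)).closure_eq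

theorem IsPolytope.exists_finite (hQ : IsPolytope Q) :
    ∃ V : Set (EuclideanSpace ℝ (Fin d)), V.Finite ∧ Q = convexHull ℝ V := by
  obtain ⟨s, rfl⟩ := hQ
  exact ⟨s, s.finite_toSet, rfl⟩

theorem isPolytope_convexHull {V : Set (EuclideanSpace ℝ (Fin d))} (hV : V.Finite) :
    IsPolytope (convexHull ℝ V) :=
  ⟨hV.toFinset, by simp⟩

theorem IsFace.isPolytope (hQ : IsPolytope Q) (hF : IsFace Q F) : IsPolytope F := by
  obtain ⟨V, hV, rfl⟩ := hQ.exists_finite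
  rw [hF.eq_convexHull hV]
  exact isPolytope_convexHull (hV.subset Set.inter_subset_left)

theorem finite_setOf_isFace (hQ : IsPolytope Q) : {F | IsFace Q F}.Finite := by
  obtain ⟨V, hV, rfl⟩ := hQ.exists_finite
  refine Set.Finite.subset (hV.finite_subsets.image (convexHull ℝ)) ?_
  intro F hF
  exact ⟨V ∩ F, Set.inter_subset_left, (IsFace.eq_convexHull hV hF).symm⟩

/-- A face of a face of a polytope is a face. -/
theorem IsFace.trans (hQ : IsPolytope Q) (hF : IsFace Q F) (hG : IsFace F G) : IsFace Q G := by
  obtain ⟨V, hV, rfl⟩ := hQ.exists_finite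
  obtain ⟨v, hv⟩ := hG.1
  obtain ⟨l, hl, hlF⟩ := hF.exists_functional_at (hG.subset hv)
  obtain ⟨g, hg, hgG⟩ := hG.exists_functional_at hv
  -- `N` is so large that, at generators off `F`, the loss in `N • l` outweighs any gain in `g`.
  -- Then `N • l + g` exposes `G` in the whole polytope.
  obtain ⟨N, hN⟩ : ∃ N : ℝ, ∀ x ∈ V, l x < l v → g x - g v < N * (l v - l x) := by
    obtain ⟨N, hN⟩ := (hV.image fun x => (g x - g v) / (l v - l x)).bddAbove
    refine ⟨N + 1, fun x hx hlx => ?_⟩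
    have h1 : (g x - g v) / (l v - l x) ≤ N := hN ⟨x, hx, rfl⟩
    rw [div_le_iff₀ (by linarith)] at h1
    nlinarith
  have hVQ := subset_convexHull ℝ V
  have hvQ : v ∈ convexHull ℝ V := hF.subset (hG.subset hv)
  have key : ∀ x ∈ V, (N • l + g) x ≤ (N • l + g) v ∧
      ((N • l + g) x = (N • l + g) v ↔ x ∈ G) := by
    intro x hx
    simp only [add_apply, smul_apply, smul_eq_mul]
    rcases (hl x (hVQ hx)).lt_or_eq with h | h
    · have h1 := hN x hx h
      refine ⟨by linarith, fun h2 => by linarith, fun h2 => ?_⟩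
      exact absurd ((hlF x).1 (hG.subset h2)).2 h.ne
    · have hxF : x ∈ F := (hlF x).2 ⟨hVQ hx, h⟩
      rw [h]
      refine ⟨by linarith [hg x hxF], fun h2 => (hgG x).2 ⟨hxF, by linarith⟩, fun h2 => ?_⟩
      rw [((hgG x).1 h2).2]
  have hmax : ∀ y ∈ convexHull ℝ V, (N • l + g) y ≤ (N • l + g) v := by
    intro y hy
    have : convexHull ℝ V ⊆ {y | (N • l + g) y ≤ (N • l + g) v} :=
      convexHull_min (fun x hx => (key x hx).1)
        (convex_halfSpace_le (N • l + g).toLinearMap.isLinear _)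
    exact this hy
  have hG' := isFace_of_functional (N • l + g) hvQ hmax
  have e1 := hG'.eq_convexHull hV
  have hF' := hF.eq_convexHull hV
  have e2 : G = convexHull ℝ (V ∩ F ∩ G) := by
    refine IsFace.eq_convexHull (hV.subset Set.inter_subset_left) ?_
    rwa [← hF']
  have e3 : V ∩ {x ∈ convexHull ℝ V | (N • l + g) x = (N • l + g) v} = V ∩ F ∩ G := by
    ext x
    constructor
    · rintro ⟨hx, -, h⟩
      have := ((key x hx).2).1 h
      exact ⟨⟨hx, hG.subset this⟩, this⟩
    · rintro ⟨⟨hx, -⟩, h⟩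
      exact ⟨hx, hVQ hx, ((key x hx).2).2 h⟩
  rw [e3, ← e2] at e1
  rwa [← e1]

theorem IsFace.isEdge_iff (hQ : IsPolytope Q) (hF : IsFace Q F) {e : Set (EuclideanSpace ℝ (Fin d))} :
    IsEdge F e ↔ IsEdge Q e ∧ e ⊆ F :=
  ⟨fun h => ⟨⟨hF.trans hQ h.1, h.2⟩, h.1.subset⟩, fun h => ⟨hF.of_subset h.1.1 h.2, h.1.2⟩⟩

theorem IsVertex.mem (h : IsVertex Q v) : v ∈ Q := IsFace.subset h rfl

theorem IsVertex.of_mem_face (hF : IsFace Q F) (h : IsVertex Q v) (hv : v ∈ F) : IsVertex F v :=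
  hF.of_subset h (by simpa using hv)

theorem IsVertex.trans (hQ : IsPolytope Q) (hF : IsFace Q F) (h : IsVertex F v) : IsVertex Q v :=
  IsFace.trans hQ hF h

theorem IsVertex.exists_functional (h : IsVertex Q v) :
    ∃ l : StrongDual ℝ (EuclideanSpace ℝ (Fin d)), ∀ y ∈ Q, y ≠ v → l y < l v := by
  obtain ⟨l, hl, hlv⟩ := IsFace.exists_functional_at h (v := v) rfl
  refine ⟨l, fun y hy hne => lt_of_le_of_ne (hl y hy) fun h => hne ?_⟩
  exact (hlv y).2 ⟨hy, h⟩

theorem IsVertex.mem_of_convexHull {V : Set (EuclideanSpace ℝ (Fin d))}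
    (h : IsVertex (convexHull ℝ V) v) : v ∈ V := by
  refine extremePoints_convexHull_subset (𝕜 := ℝ) ?_
  exact exposedPoints_subset_extremePoints
    (mem_exposedPoints_iff_exposed_singleton.2 (And.right h))

end Faces

/-! ### Edges and the cone of a polytope at a vertex -/

section Edges

variable {d : ℕ} {Q F e e' : Set (EuclideanSpace ℝ (Fin d))} {v p : EuclideanSpace ℝ (Fin d)}

theorem IsEdge.exists_smul (he : IsEdge Q e) (hv : v ∈ e) (hp : p ∈ e) (hne : p ≠ v)
    {x : EuclideanSpace ℝ (Fin d)} (hx : x ∈ e) : ∃ t : ℝ, x - v = t • (p - v) := by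
  have hpv : (⟨p - v, vsub_mem_vectorSpan ℝ hp hv⟩ : vectorSpan ℝ e) ≠ 0 := by
    intro h
    exact hne (sub_eq_zero.1 (congrArg Subtype.val h))
  obtain ⟨t, ht⟩ := (finrank_eq_one_iff_of_nonzero' _ hpv).1 he.2
    ⟨x - v, vsub_mem_vectorSpan ℝ hx hv⟩
  exact ⟨t, (congrArg Subtype.val ht).symm⟩

theorem IsEdge.exists_ne (he : IsEdge Q e) (hv : v ∈ e) : ∃ p ∈ e, p ≠ v := by
  by_contra! h
  have h1 : e = {v} := Set.eq_singleton_iff_unique_mem.2 ⟨hv, h⟩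
  have h2 := he.2
  rw [h1, faceDim, vectorSpan_singleton, finrank_bot] at h2
  exact zero_ne_one h2

/-- An edge meeting a face in two points is contained in it. -/
theorem IsEdge.subset_face (he : IsEdge Q e) (hF : IsFace Q F) (hv : v ∈ e) (hp : p ∈ e)
    (hne : p ≠ v) (hvF : v ∈ F) (hpF : p ∈ F) : e ⊆ F := by
  intro x hx
  obtain ⟨l, -, hlF⟩ := hF.exists_functional_at hvF
  obtain ⟨t, ht⟩ := he.exists_smul hv hp hne hx
  refine (hlF x).2 ⟨he.1.subset hx, ?_⟩
  have h1 : l (x - v) = t * l (p - v) := by rw [ht, map_smul, smul_eq_mul]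
  rw [map_sub, map_sub, ((hlF p).1 hpF).2] at h1
  linarith

theorem IsEdge.eq_of_mem (he : IsEdge Q e) (he' : IsEdge Q e') (hv : v ∈ e) (hp : p ∈ e)
    (hne : p ≠ v) (hv' : v ∈ e') (hp' : p ∈ e') : e = e' :=
  (he.subset_face he'.1 hv hp hne hv' hp').antisymm (he'.subset_face he.1 hv' hp' hne hv hp)

theorem mem_cone_of_mem_convexHull {V : Set (EuclideanSpace ℝ (Fin d))}
    {W : Finset (EuclideanSpace ℝ (Fin d))}
    (h : ∀ x ∈ V, ∃ t : EuclideanSpace ℝ (Fin d) → ℝ, (∀ q, 0 ≤ t q) ∧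
      x - v = ∑ q ∈ W, t q • (q - v)) {x : EuclideanSpace ℝ (Fin d)} (hx : x ∈ convexHull ℝ V) :
    ∃ t : EuclideanSpace ℝ (Fin d) → ℝ, (∀ q, 0 ≤ t q) ∧ x - v = ∑ q ∈ W, t q • (q - v) := by
  refine convexHull_min (t := {x | ∃ t : EuclideanSpace ℝ (Fin d) → ℝ, (∀ q, 0 ≤ t q) ∧
    x - v = ∑ q ∈ W, t q • (q - v)}) h ?_ hx
  rintro x ⟨t, ht, hx⟩ y ⟨t', ht', hy⟩ a b ha hb hab
  refine ⟨fun q => a * t q + b * t' q, fun q => ?_, ?_⟩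
  · have := ht q
    have := ht' q
    positivity
  · have h1 : a • x + b • y - v = a • (x - v) + b • (y - v) := by
      obtain rfl : a = 1 - b := by linarith
      module
    rw [h1, hx, hy, Finset.smul_sum, Finset.smul_sum, ← Finset.sum_add_distrib]
    refine Finset.sum_congr rfl fun q _ => ?_
    module

open Finset in
/-- A minimal generating set for the cone of a polytope at a vertex consists of points on edges. -/
theorem IsVertex.isEdge_of_minimal {W : Finset (EuclideanSpace ℝ (Fin d))}
    (hv : IsVertex Q v) (hWQ : ∀ q ∈ W, q ∈ Q)
    (hcone : ∀ x ∈ Q, ∃ t : EuclideanSpace ℝ (Fin d) → ℝ, (∀ q, 0 ≤ t q) ∧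
      x - v = ∑ q ∈ W, t q • (q - v)) (hvW : v ∉ W) (hp : p ∈ W)
    (hmin : ¬ ∃ t : EuclideanSpace ℝ (Fin d) → ℝ, (∀ q, 0 ≤ t q) ∧
      p - v = ∑ q ∈ W.erase p, t q • (q - v)) :
    ∃ e, IsEdge Q e ∧ v ∈ e ∧ p ∈ e := by
  classical
  obtain ⟨l, hl⟩ := hv.exists_functional
  have hW : ∀ q ∈ W, l q < l v := fun q hq => hl q (hWQ q hq) (ne_of_mem_of_not_mem hq hvW)
  -- Vertex figure: each direction `q - v` is rescaled to the hyperplane `l = -1`. By minimality of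
  -- `W`, the point `N p` is outside the hull of the others and can be separated from it.
  let N : EuclideanSpace ℝ (Fin d) → EuclideanSpace ℝ (Fin d) := fun q => (l v - l q)⁻¹ • (q - v)
  have hdisj : N p ∉ convexHull ℝ (N '' (W.erase p : Set (EuclideanSpace ℝ (Fin d)))) := by
    intro hmem
    obtain ⟨t, ht, h⟩ := mem_cone_of_mem_convexHull (v := 0) (W := (W.erase p).image N)
      (fun x hx => by
        refine ⟨fun q => if q = x then 1 else 0, fun q => by dsimp only; split_ifs <;> norm_num, ?_⟩
        have hx' : x ∈ (W.erase p).image N := by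
          rw [← coe_image] at hx
          exact_mod_cast hx
        simp only [ite_smul, one_smul, zero_smul]
        rw [Finset.sum_ite_eq' _ _ _, if_pos hx']) hmem
    have hconeN : ∀ y ∈ (W.erase p).image N, ∃ s : EuclideanSpace ℝ (Fin d) → ℝ,
        (∀ q, 0 ≤ s q) ∧ y = ∑ q ∈ W.erase p, s q • (q - v) := by
      intro y hy
      obtain ⟨q, hq, rfl⟩ := mem_image.1 hy
      refine ⟨fun x => if x = q then (l v - l q)⁻¹ else 0, fun x => ?_, ?_⟩
      · have := hW q (mem_of_mem_erase hq)
        dsimp only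
        split_ifs
        · exact inv_nonneg.2 (by linarith)
        · exact le_rfl
      · simp only [ite_smul, zero_smul]
        rw [Finset.sum_ite_eq' _ _ _, if_pos hq]
    choose! s hs hs' using hconeN
    refine hmin ⟨fun q => (l v - l p) * ∑ y ∈ (W.erase p).image N, t y * s y q,
      fun q => ?_, ?_⟩
    · have := hW p hp
      refine mul_nonneg (by linarith) (sum_nonneg fun y hy => mul_nonneg (ht y) (hs y hy q))
    · have h1 : p - v = (l v - l p) • N p := by
        have := hW p hp
        simp only [N]
        rw [smul_inv_smul₀ (by linarith)]
      rw [sub_zero] at h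
      rw [h1, h]
      simp only [sub_zero, mul_smul, sum_smul]
      rw [← Finset.smul_sum, Finset.sum_comm]
      congr 1
      refine Finset.sum_congr rfl fun y hy => ?_
      rw [← Finset.smul_sum, ← hs' y hy]
  obtain ⟨f, u, hfu, hf⟩ := geometric_hahn_banach_closed_point (convex_convexHull ℝ _)
    (((W.erase p).finite_toSet.image N).isClosed_convexHull (𝕜 := ℝ)) hdisj
  -- Since `l = -1` on all `N q`, the correction makes `g` vanish at `N p` and stay negative at the
  -- other `N q`. So `g` is maximal at `v`, and only the ray through `p` is tied.
  let g : StrongDual ℝ (EuclideanSpace ℝ (Fin d)) := f + f (N p) • l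
  have hNl : ∀ q ∈ W, l (N q) = -1 := by
    intro q hq
    have := hW q hq
    simp only [N, map_smul, map_sub, smul_eq_mul]
    rw [inv_mul_eq_div, div_eq_iff (by linarith)]
    ring
  have hgN : ∀ q ∈ W, g (q - v) = (l v - l q) * (f (N q) - f (N p)) := by
    intro q hq
    have h0 := hW q hq
    have h1 : q - v = (l v - l q) • N q := by
      simp only [N]
      rw [smul_inv_smul₀ (by linarith)]
    rw [h1, map_smul, smul_eq_mul]
    simp only [g, add_apply, smul_apply, smul_eq_mul]
    rw [hNl q hq]
    ring
  have hgp : g (p - v) = 0 := by rw [hgN p hp]; ring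
  have hgq : ∀ q ∈ W, q ≠ p → g (q - v) < 0 := by
    intro q hq hqp
    have h1 := hfu (N q) (subset_convexHull ℝ _ ⟨q, by simp [hq, hqp], rfl⟩)
    have h2 := hW q hq
    rw [hgN q hq]
    nlinarith
  have hgW : ∀ q ∈ W, g (q - v) ≤ 0 := by
    intro q hq
    by_cases h : q = p
    · rw [h, hgp]
    · exact (hgq q hq h).le
  have hgQ : ∀ x ∈ Q, g x ≤ g v := by
    intro x hx
    obtain ⟨t, ht, hxt⟩ := hcone x hx
    have : g (x - v) ≤ 0 := by
      rw [hxt, map_sum]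
      refine sum_nonpos fun q hq => ?_
      rw [map_smul, smul_eq_mul]
      exact mul_nonpos_of_nonneg_of_nonpos (ht q) (hgW q hq)
    rw [map_sub] at this
    linarith
  have hface := isFace_of_functional g hv.mem hgQ
  have hpe : p ∈ {x ∈ Q | g x = g v} := ⟨hWQ p hp, by rw [map_sub] at hgp; linarith⟩
  have hve : v ∈ {x ∈ Q | g x = g v} := ⟨hv.mem, rfl⟩
  refine ⟨_, ⟨hface, ?_⟩, hve, hpe⟩
  have hpv : p ≠ v := ne_of_mem_of_not_mem hp hvW
  have hspan : vectorSpan ℝ {x ∈ Q | g x = g v} = Submodule.span ℝ {p - v} := by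
    refine le_antisymm ?_ ?_
    · rw [vectorSpan_eq_span_vsub_set_right ℝ hve, Submodule.span_le]
      rintro _ ⟨x, ⟨hx, hgx⟩, rfl⟩
      obtain ⟨t, ht, hxt⟩ := hcone x hx
      have hsum : ∑ q ∈ W, t q * g (q - v) = 0 := by
        have : g (x - v) = 0 := by rw [map_sub, hgx, sub_self]
        rw [hxt, map_sum] at this
        simpa using this
      have hz := (sum_eq_zero_iff_of_nonpos fun q hq =>
        mul_nonpos_of_nonneg_of_nonpos (ht q) (hgW q hq)).1 hsum
      have : x - v = t p • (p - v) := by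
        rw [hxt]
        refine sum_eq_single_of_mem p hp fun q hq hqp => ?_
        have h0 : t q = 0 := by
          rcases mul_eq_zero.1 (hz q hq) with h | h
          · exact h
          · exact absurd h (hgq q hq hqp).ne
        rw [h0, zero_smul]
      change x - v ∈ _
      rw [this]
      exact Submodule.smul_mem _ _ (Submodule.mem_span_singleton_self _)
    · rw [Submodule.span_le, Set.singleton_subset_iff]
      exact vsub_mem_vectorSpan ℝ hpe hve
  rw [faceDim, hspan, finrank_span_singleton (sub_ne_zero.2 hpv)]

open Finset in
/-- A polytope is contained in the cone spanned by its edges at a vertex. -/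
theorem IsVertex.exists_edge_cone (hQ : IsPolytope Q) (hv : IsVertex Q v) :
    ∃ W : Finset (EuclideanSpace ℝ (Fin d)),
      (∀ p ∈ W, p ≠ v ∧ ∃ e, IsEdge Q e ∧ v ∈ e ∧ p ∈ e) ∧
      ∀ x ∈ Q, ∃ t : EuclideanSpace ℝ (Fin d) → ℝ, (∀ q, 0 ≤ t q) ∧
        x - v = ∑ q ∈ W, t q • (q - v) := by
  classical
  obtain ⟨V, rfl⟩ := hQ
  obtain ⟨W, hWV, hW, hmin⟩ := exists_minimal_finset
    (fun W : Finset (EuclideanSpace ℝ (Fin d)) => ∀ x ∈ V,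
      ∃ t : EuclideanSpace ℝ (Fin d) → ℝ, (∀ q, 0 ≤ t q) ∧ x - v = ∑ q ∈ W, t q • (q - v)) V
    (fun x hx => by
      refine ⟨fun q => if q = x then 1 else 0, fun q => by dsimp only; split_ifs <;> norm_num, ?_⟩
      simp only [ite_smul, one_smul, zero_smul]
      rw [Finset.sum_ite_eq' _ _ _, if_pos hx])
  have hcone := fun x hx => mem_cone_of_mem_convexHull (V := (V : Set _)) (v := v) (W := W)
    hW (x := x) hx
  have herase : ∀ p ∈ W, ¬ ∃ t : EuclideanSpace ℝ (Fin d) → ℝ, (∀ q, 0 ≤ t q) ∧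
      p - v = ∑ q ∈ W.erase p, t q • (q - v) := by
    rintro p hp ⟨t, ht, h⟩
    refine hmin _ (erase_ssubset hp) fun x hx => ?_
    obtain ⟨s, hs, hxs⟩ := hW x hx
    refine ⟨fun q => s q + s p * t q, fun q => ?_, ?_⟩
    · have := hs q
      have := hs p
      have := ht q
      positivity
    · rw [hxs, ← add_sum_erase _ _ hp, h, Finset.smul_sum, ← sum_add_distrib]
      refine sum_congr rfl fun q _ => ?_
      module
  have hvW : v ∉ W := by
    intro h
    exact herase v h ⟨fun _ => 0, fun _ => le_rfl, by simp⟩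
  refine ⟨W, fun p hp => ⟨ne_of_mem_of_not_mem hp hvW, ?_⟩, hcone⟩
  exact hv.isEdge_of_minimal (fun q hq => subset_convexHull ℝ _ (hWV hq)) hcone hvW hp
    (herase p hp)

theorem IsFace.exists_edge_cone (hQ : IsPolytope Q) (hF : IsFace Q F) (hv : IsVertex Q v)
    (hvF : v ∈ F) :
    ∃ W : Finset (EuclideanSpace ℝ (Fin d)),
      (∀ p ∈ W, p ≠ v ∧ ∃ e, IsEdge Q e ∧ v ∈ e ∧ p ∈ e ∧ e ⊆ F) ∧
      ∀ x ∈ F, ∃ t : EuclideanSpace ℝ (Fin d) → ℝ, (∀ q, 0 ≤ t q) ∧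
        x - v = ∑ q ∈ W, t q • (q - v) := by
  obtain ⟨W, hW, hcone⟩ := (hv.of_mem_face hF hvF).exists_edge_cone (hF.isPolytope hQ)
  refine ⟨W, fun p hp => ⟨(hW p hp).1, ?_⟩, hcone⟩
  obtain ⟨e, he, hve, hpe⟩ := (hW p hp).2
  exact ⟨e, ((hF.isEdge_iff hQ).1 he).1, hve, hpe, he.1.subset⟩

/-- A face with more than one point has an edge at each of its vertices. -/
theorem IsFace.exists_edge (hQ : IsPolytope Q) (hF : IsFace Q F) (hv : IsVertex Q v)
    (hvF : v ∈ F) (hp : p ∈ F) (hne : p ≠ v) : ∃ e, IsEdge Q e ∧ v ∈ e ∧ e ⊆ F := by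
  obtain ⟨W, hW, hcone⟩ := hF.exists_edge_cone hQ hv hvF
  obtain ⟨t, -, hpt⟩ := hcone p hp
  have : W.Nonempty := by
    rw [Finset.nonempty_iff_ne_empty]
    rintro rfl
    rw [Finset.sum_empty, sub_eq_zero] at hpt
    exact hne hpt
  obtain ⟨q, hq⟩ := this
  obtain ⟨-, e, he, hve, -, heF⟩ := hW q hq
  exact ⟨e, he, hve, heF⟩

/-- A generator `v` of largest norm is a vertex: by Cauchy–Schwarz, `⟨v, ·⟩` is maximal at `v` and
nowhere else in the ball of radius `‖v‖`. -/
theorem IsPolytope.exists_isVertex (hQ : IsPolytope Q) (hne : Q.Nonempty) :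
    ∃ v, IsVertex Q v := by
  obtain ⟨V, hV, rfl⟩ := hQ.exists_finite
  obtain ⟨v, hvV, hv⟩ := hV.exists_maximalFor (fun x => ‖x‖) _ (convexHull_nonempty_iff.1 hne)
  have hmax : ∀ y ∈ convexHull ℝ V, ‖y‖ ≤ ‖v‖ := by
    intro y hy
    obtain ⟨z, hz, hyz⟩ := (convexOn_norm (convex_convexHull ℝ V)).exists_ge_of_mem_convexHull
      (subset_convexHull ℝ V) hy
    exact hyz.trans (le_of_not_gt fun h => (h.trans_le (hv hz h.le)).false)
  refine ⟨v, Set.singleton_nonempty v, fun _ => ⟨innerSL ℝ v, ?_⟩⟩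
  have hvQ := subset_convexHull ℝ V hvV
  have hle : ∀ y ∈ convexHull ℝ V, inner ℝ v y ≤ inner ℝ v v := by
    intro y hy
    rw [real_inner_self_eq_norm_sq]
    nlinarith [real_inner_le_norm v y, hmax y hy, norm_nonneg v]
  ext x
  simp only [Set.mem_singleton_iff, innerSL_apply_apply, Set.mem_ofPred_eq]
  constructor
  · rintro rfl
    exact ⟨hvQ, hle⟩
  · rintro ⟨hx, h⟩
    have h1 := h v hvQ
    have h2 : ‖x - v‖ ^ 2 = ‖x‖ ^ 2 - 2 * inner ℝ x v + ‖v‖ ^ 2 := norm_sub_sq_real x v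
    rw [real_inner_self_eq_norm_sq, real_inner_comm] at h1
    have h3 := hmax x hx
    have h4 := norm_nonneg x
    have h5 : ‖x - v‖ ^ 2 ≤ 0 := by nlinarith
    have h6 : ‖x - v‖ = 0 := by
      have := sq_nonneg ‖x - v‖
      exact pow_eq_zero_iff two_ne_zero |>.1 (le_antisymm h5 this)
    exact sub_eq_zero.1 (norm_eq_zero.1 h6)

end Edges

/-! ### Directionally simple polytopes and out-degrees -/

section DirectionallySimple

variable {d : ℕ} {Q F F' e : Set (EuclideanSpace ℝ (Fin d))} {c v p : EuclideanSpace ℝ (Fin d)}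

/-- A face is determined by its edges at one of its vertices. -/
theorem IsFace.subset_of_edges_subset (hQ : IsPolytope Q) (hF : IsFace Q F) (hF' : IsFace Q F')
    (hv : IsVertex Q v) (hvF : v ∈ F) (hvF' : v ∈ F')
    (h : ∀ e, IsEdge Q e → v ∈ e → e ⊆ F → e ⊆ F') : F ⊆ F' := by
  intro x hx
  obtain ⟨W, hW, hcone⟩ := hF.exists_edge_cone hQ hv hvF
  obtain ⟨l, -, hlF'⟩ := hF'.exists_functional_at hvF'
  obtain ⟨t, -, hxt⟩ := hcone x hx
  refine (hlF' x).2 ⟨hF.subset hx, ?_⟩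
  have h0 : l (x - v) = 0 := by
    rw [hxt, map_sum]
    refine Finset.sum_eq_zero fun q hq => ?_
    obtain ⟨-, e, he, hve, hqe, heF⟩ := hW q hq
    rw [map_smul, map_sub, ((hlF' q).1 (h e he hve heF hqe)).2, sub_self, smul_zero]
  rwa [map_sub, sub_eq_zero] at h0

/-- `x - v` is a nonnegative combination of edge directions of `F`, and `c` is positive on each of
them. -/
theorem IsFace.inner_lt_of_edges (hQ : IsPolytope Q) (hF : IsFace Q F) (hv : IsVertex Q v)
    (hvF : v ∈ F) (h : ∀ e, IsEdge Q e → v ∈ e → e ⊆ F → e ∈ outEdges Q c v) :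
    ∀ x ∈ F, x ≠ v → inner ℝ c v < inner ℝ c x := by
  intro x hx hne
  obtain ⟨W, hW, hcone⟩ := hF.exists_edge_cone hQ hv hvF
  obtain ⟨t, ht, hxt⟩ := hcone x hx
  have hpos : ∀ q ∈ W, 0 < inner ℝ c (q - v) := by
    intro q hq
    obtain ⟨hqv, e, he, hve, hqe, heF⟩ := hW q hq
    rw [inner_sub_right, sub_pos]
    exact (h e he hve heF).2.2 q hqe hqv
  have hsum : inner ℝ c (x - v) = ∑ q ∈ W, t q * inner ℝ c (q - v) := by
    rw [hxt, inner_sum]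
    exact Finset.sum_congr rfl fun q _ => by rw [inner_smul_right]
  rw [← sub_pos, ← inner_sub_right, hsum]
  refine lt_of_le_of_ne (Finset.sum_nonneg fun q hq => mul_nonneg (ht q) (hpos q hq).le) ?_
  intro h0
  have hz := (Finset.sum_eq_zero_iff_of_nonneg
    fun q hq => mul_nonneg (ht q) (hpos q hq).le).1 h0.symm
  refine hne (sub_eq_zero.1 ?_)
  rw [hxt]
  refine Finset.sum_eq_zero fun q hq => ?_
  rcases mul_eq_zero.1 (hz q hq) with h1 | h1
  · rw [h1, zero_smul]
  · exact absurd h1 (hpos q hq).ne'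

/-- On every face a generic linear functional is minimized at a single vertex. -/
theorem IsFace.exists_min_vertex (hQ : IsPolytope Q) (hc : IsGeneric Q c) (hF : IsFace Q F) :
    ∃ v, IsVertex Q v ∧ v ∈ F ∧ ∀ x ∈ F, x ≠ v → inner ℝ c v < inner ℝ c x := by
  have hFc : IsCompact F := by
    obtain ⟨V, hV, h⟩ := (hF.isPolytope hQ).exists_finite
    rw [h]
    exact hV.isCompact_convexHull (𝕜 := ℝ)
  obtain ⟨m, hmF, hm⟩ := hFc.exists_isMinOn hF.1
    (f := fun x => inner ℝ c x) (innerSL ℝ c).continuous.continuousOn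
  have hG : IsFace F {x ∈ F | (-innerSL ℝ c) x = (-innerSL ℝ c) m} := by
    refine isFace_of_functional _ hmF fun y hy => ?_
    have := hm hy
    simpa using this
  set G := {x ∈ F | (-innerSL ℝ c) x = (-innerSL ℝ c) m}
  have hGQ : IsFace Q G := hF.trans hQ hG
  have hGc : ∀ x ∈ G, inner ℝ c x = inner ℝ c m := by
    rintro x ⟨-, h⟩
    simpa using h
  obtain ⟨v, hvG⟩ := (hGQ.isPolytope hQ).exists_isVertex hGQ.1
  have hv : IsVertex Q v := hvG.trans hQ hGQ
  refine ⟨v, hv, hG.subset hvG.mem, fun x hx hne => ?_⟩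
  have h1 : inner ℝ c v ≤ inner ℝ c x := by
    rw [hGc v hvG.mem]
    exact hm hx
  refine lt_of_le_of_ne h1 fun h2 => ?_
  have hxG : x ∈ G := by
    refine ⟨hx, ?_⟩
    have := h2.symm.trans (hGc v hvG.mem)
    simpa using this
  -- A second minimizer would give the minimizing face `G` an edge, on which `c` is constant,
  -- against genericity.
  obtain ⟨e, he, -, heG⟩ := hGQ.exists_edge hQ hv hvG.mem hxG hne
  obtain ⟨x, hx, y, hy, hxy⟩ := hc e he
  refine hxy ?_
  rw [inner_sub_right, hGc x (heG hx), hGc y (heG hy), sub_self]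

/-- The dimension of a face of a directionally simple polytope is its number of out-edges at its
source. -/
theorem faceDim_eq_ncard (hQ : IsPolytope Q) (hds : IsDirectionallySimple Q c)
    (hv : IsVertex Q v) (hF : IsFace Q F) (hvF : v ∈ F)
    (hE : {e | IsEdge Q e ∧ v ∈ e ∧ e ⊆ F} ⊆ outEdges Q c v) :
    faceDim F = {e | IsEdge Q e ∧ v ∈ e ∧ e ⊆ F}.ncard := by
  classical
  set E := {e | IsEdge Q e ∧ v ∈ e ∧ e ⊆ F} with hEdef
  have hfin : E.Finite := (finite_setOf_isFace hQ).subset fun e he => he.1.1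
  have hfin' : Fintype E := hfin.fintype
  have hex : ∀ e : E, ∃ p ∈ (e : Set (EuclideanSpace ℝ (Fin d))), p ≠ v :=
    fun e => e.2.1.exists_ne e.2.2.1
  choose p hp hpv using hex
  have hli : LinearIndependent ℝ fun e : E => p e - v := by
    -- A functional exposing the face with edge set `E \ {e}` is zero on every direction of `E`
    -- except that of `e`; these functionals act as a dual family.
    have hl : ∀ e : E, ∃ l : StrongDual ℝ (EuclideanSpace ℝ (Fin d)),
        l (p e - v) ≠ 0 ∧ ∀ f : E, f ≠ e → l (p f - v) = 0 := by
      intro e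
      obtain ⟨G, hG, hvG, hGE⟩ := hds v hv (E \ {(e : Set _)}) (Set.sdiff_subset.trans hE)
      obtain ⟨l, -, hlG⟩ := hG.exists_functional_at hvG
      refine ⟨l, fun h => ?_, fun f hf => ?_⟩
      · rw [map_sub, sub_eq_zero] at h
        have hpG : p e ∈ G := (hlG _).2 ⟨e.2.1.1.subset (hp e), h⟩
        have heG := e.2.1.subset_face hG e.2.2.1 (hp e) (hpv e) hvG hpG
        have : (e : Set _) ∈ E \ {(e : Set _)} := by
          rw [← hGE]
          exact ⟨e.2.1, e.2.2.1, heG⟩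
        exact this.2 rfl
      · have : (f : Set _) ∈ E \ {(e : Set _)} := ⟨f.2, fun h => hf (Subtype.ext h)⟩
        rw [← hGE] at this
        rw [map_sub, ((hlG _).1 (this.2.2 (hp f))).2, sub_self]
    choose l hl1 hl2 using hl
    rw [Fintype.linearIndependent_iff]
    intro g hg e
    have h1 : l e (∑ i, g i • (p i - v)) = 0 := by rw [hg, map_zero]
    rw [map_sum, Finset.sum_eq_single e] at h1
    · rw [map_smul, smul_eq_mul] at h1
      exact (mul_eq_zero.1 h1).resolve_right (hl1 e)
    · intro f _ hf
      rw [map_smul, hl2 e f hf, smul_zero]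
    · simp
  have hspan : vectorSpan ℝ F = Submodule.span ℝ (Set.range fun e : E => p e - v) := by
    refine le_antisymm ?_ ?_
    · obtain ⟨W, hW, hcone⟩ := hF.exists_edge_cone hQ hv hvF
      rw [vectorSpan_eq_span_vsub_set_right ℝ hvF, Submodule.span_le]
      rintro _ ⟨x, hx, rfl⟩
      obtain ⟨t, -, hxt⟩ := hcone x hx
      change x - v ∈ _
      rw [hxt]
      refine Submodule.sum_mem _ fun q hq => Submodule.smul_mem _ _ ?_
      obtain ⟨-, e, he, hve, hqe, heF⟩ := hW q hq
      obtain ⟨s, hs⟩ := he.exists_smul hve (hp ⟨e, he, hve, heF⟩) (hpv ⟨e, he, hve, heF⟩) hqe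
      rw [hs]
      exact Submodule.smul_mem _ _ (Submodule.subset_span ⟨⟨e, he, hve, heF⟩, rfl⟩)
    · rw [Submodule.span_le]
      rintro _ ⟨e, rfl⟩
      exact vsub_mem_vectorSpan ℝ (e.2.2.2 (hp e)) hvF
  rw [faceDim, hspan, finrank_span_eq_card hli, ← Nat.card_coe_set_eq, Nat.card_eq_fintype_card]

open Polynomial in
/-- The `h`-polynomial of a directionally simple polytope is the generating function of the
out-degrees. -/
theorem hPolynomial_eq (hQ : IsPolytope Q) (hc : IsGeneric Q c)
    (hds : IsDirectionallySimple Q c) (hV : {v | IsVertex Q v}.Finite) :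
    ∑ i ∈ Finset.range (d + 1), C (fVector Q i : ℤ) * (X - 1 : ℤ[X]) ^ i =
      ∑ v ∈ hV.toFinset, X ^ (outEdges Q c v).ncard := by
  classical
  have hfin := finite_setOf_isFace hQ
  have hfinE : ∀ v, (outEdges Q c v).Finite := fun v => hfin.subset fun e he => he.1.1
  have h1 : ∑ i ∈ Finset.range (d + 1), C (fVector Q i : ℤ) * (X - 1 : ℤ[X]) ^ i =
      ∑ F ∈ hfin.toFinset, (X - 1 : ℤ[X]) ^ faceDim F := by
    rw [← Finset.sum_fiberwise_of_maps_to (g := faceDim) (t := Finset.range (d + 1))]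
    · refine Finset.sum_congr rfl fun i _ => ?_
      have h2 : ∀ F ∈ hfin.toFinset.filter (fun F => faceDim F = i),
          (X - 1 : ℤ[X]) ^ faceDim F = (X - 1) ^ i := by
        intro F hF
        rw [(Finset.mem_filter.1 hF).2]
      rw [Finset.sum_congr rfl h2, Finset.sum_const, nsmul_eq_mul]
      have h3 : fVector Q i = (hfin.toFinset.filter (fun F => faceDim F = i)).card := by
        rw [fVector, ← Set.ncard_coe_finset]
        congr 1
        ext F
        simp
      rw [h3]
      simp
    · intro F _
      rw [Finset.mem_range, Nat.lt_succ_iff]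
      calc faceDim F ≤ Module.finrank ℝ (EuclideanSpace ℝ (Fin d)) := Submodule.finrank_le _
        _ = d := finrank_euclideanSpace_fin
  rw [h1]
  have hmin : ∀ F, IsFace Q F → ∃ v, IsVertex Q v ∧ v ∈ F ∧
      ∀ x ∈ F, x ≠ v → inner ℝ c v < inner ℝ c x := fun F hF => hF.exists_min_vertex hQ hc
  -- `m F` is the source of `F`; the sum over faces is split by source.
  choose! m hmV hmF hm using hmin
  rw [← Finset.sum_fiberwise_of_maps_to (g := m) (t := hV.toFinset)
    (fun F hF => by simpa using hmV F (by simpa using hF))]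
  refine Finset.sum_congr rfl fun v hv => ?_
  have hv : IsVertex Q v := by simpa using hv
  -- Binomial expansion of `((X - 1) + 1) ^ outdeg`, indexed by sets of out-edges.
  have hbin : (X : ℤ[X]) ^ (outEdges Q c v).ncard =
      ∑ E ∈ (hfinE v).toFinset.powerset, (X - 1 : ℤ[X]) ^ E.card := by
    have := Finset.sum_pow_mul_eq_add_pow (X - 1 : ℤ[X]) 1 (hfinE v).toFinset
    simp only [one_pow, mul_one, sub_add_cancel] at this
    rw [this, Set.ncard_eq_toFinset_card _ (hfinE v)]
  rw [hbin]
  have hfinF : ∀ F : Set (EuclideanSpace ℝ (Fin d)), {e | IsEdge Q e ∧ v ∈ e ∧ e ⊆ F}.Finite :=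
    fun F => hfin.subset fun e he => he.1.1
  have hmem : ∀ F, F ∈ hfin.toFinset.filter (fun F => m F = v) ↔ IsFace Q F ∧ m F = v := by
    intro F
    simp
  have hout : ∀ F, IsFace Q F → m F = v →
      {e | IsEdge Q e ∧ v ∈ e ∧ e ⊆ F} ⊆ outEdges Q c v := by
    rintro F hF rfl e ⟨he, hve, heF⟩
    exact ⟨he, hve, fun x hx hne => hm F hF x (heF hx) hne⟩
  -- A face with source `v` corresponds to its edges at `v`. Surjectivity is directional simplicity.
  refine Finset.sum_bij (fun F _ => (hfinF F).toFinset) ?_ ?_ ?_ ?_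
  · intro F hF
    obtain ⟨hF, hFv⟩ := (hmem F).1 hF
    simpa using hout F hF hFv
  · intro F hF0 F' hF0' h
    obtain ⟨hF, rfl⟩ := (hmem F).1 hF0
    obtain ⟨hF', hFF'⟩ := (hmem F').1 hF0'
    have hvF' : m F ∈ F' := hFF' ▸ hmF F' hF'
    have h' : {e | IsEdge Q e ∧ m F ∈ e ∧ e ⊆ F} = {e | IsEdge Q e ∧ m F ∈ e ∧ e ⊆ F'} := by
      simpa using h
    refine (hF.subset_of_edges_subset hQ hF' hv (hmF F hF) hvF' ?_).antisymm
      (hF'.subset_of_edges_subset hQ hF hv hvF' (hmF F hF) ?_)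
    · intro e he hve heF
      exact (h'.subset ⟨he, hve, heF⟩).2.2
    · intro e he hve heF
      exact (h'.superset ⟨he, hve, heF⟩).2.2
  · intro E hE
    have hE' : (E : Set (Set (EuclideanSpace ℝ (Fin d)))) ⊆ outEdges Q c v := by
      simpa using hE
    obtain ⟨F, hF, hvF, hFE⟩ := hds v hv E hE'
    refine ⟨F, (hmem F).2 ⟨hF, ?_⟩, ?_⟩
    · have h2 := hF.inner_lt_of_edges hQ hv hvF (c := c) fun e he hve heF =>
        hE' (hFE.subset ⟨he, hve, heF⟩)
      by_contra hne
      exact (h2 (m F) (hmF F hF) hne).asymm (hm F hF v hvF (Ne.symm hne))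
    · rw [← Finset.coe_inj]
      simpa using hFE
  · intro F hF
    obtain ⟨hF, hFv⟩ := (hmem F).1 hF
    rw [faceDim_eq_ncard hQ hds hv hF (hFv ▸ hmF F hF) (hout F hF hFv),
      Set.ncard_eq_toFinset_card _ (hfinF F)]

theorem finite_setOf_isVertex (hQ : IsPolytope Q) : {v | IsVertex Q v}.Finite :=
  Set.Finite.of_finite_image ((finite_setOf_isFace hQ).subset (by
    rintro _ ⟨v, hv, rfl⟩
    exact hv)) (f := fun v => ({v} : Set (EuclideanSpace ℝ (Fin d))))
    (Set.singleton_injective.injOn)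

theorem hVector_eq_ncard (hQ : IsPolytope Q) (hc : IsGeneric Q c)
    (hds : IsDirectionallySimple Q c) (k : ℕ) :
    hVector Q k = (({v | IsVertex Q v ∧ (outEdges Q c v).ncard = k}.ncard : ℕ) : ℤ) := by
  classical
  have hV := finite_setOf_isVertex hQ
  rw [hVector, hPolynomial_eq hQ hc hds hV, Polynomial.finsetSum_coeff]
  simp only [Polynomial.coeff_X_pow]
  rw [Finset.sum_boole]
  congr 1
  rw [← Set.ncard_coe_finset]
  congr 1
  ext v
  simp [eq_comm]

end DirectionallySimple

open Equiv

/-! ### Length, weak order and Bruhat order on permutations -/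

section Bruhat

variable {n : ℕ} {u v w y z : Perm (Fin n)} {i j k k' p q : Fin n}

theorem perm_apply_inv (u : Perm (Fin n)) (p : Fin n) : u (u⁻¹ p) = p := by
  rw [← Perm.mul_apply, mul_inv_cancel, Perm.one_apply]

theorem swap_lt_swap_of_adjacent (hij : (i : ℕ) + 1 = j) (hpq : p < q) (h : ¬ (p = i ∧ q = j)) :
    swap i j p < swap i j q := by
  simp only [swap_apply_def]
  simp only [Fin.ext_iff, Fin.lt_def] at hpq h ⊢
  split_ifs <;> omega

theorem strictMono_of_adjacent {f : Fin n → Fin n}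
    (h : ∀ i j : Fin n, (i : ℕ) + 1 = j → f i < f j) : StrictMono f := by
  have key : ∀ m : ℕ, ∀ i j : Fin n, (i : ℕ) + m + 1 = j → f i < f j := by
    intro m
    induction m with
    | zero => exact fun i j hij => h i j hij
    | succ m ih =>
      intro i j hij
      have hlt : (i : ℕ) + m + 1 < n := by omega
      exact (ih i ⟨_, hlt⟩ rfl).trans (h ⟨_, hlt⟩ j (by simp only; omega))
  intro i j hij
  exact key (j - i - 1) i j (by have := Fin.lt_def.1 hij; omega)

theorem eq_one_of_adjacent (h : ∀ i j : Fin n, (i : ℕ) + 1 = j → u i < u j) : u = 1 := by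
  have hm := strictMono_of_adjacent h
  have : hm.orderIsoOfSurjective u u.surjective = OrderIso.refl _ := Subsingleton.elim _ _
  ext x
  exact congrArg (fun e : Fin n ≃o Fin n => (e x : ℕ)) this

/-! ### Inversions and length -/

/-- The pairs of values that appear in the wrong order in the one-line notation of `u`. -/
def invSet (u : Perm (Fin n)) : Finset (Fin n × Fin n) :=
  Finset.univ.filter fun x => x.1 < x.2 ∧ u⁻¹ x.2 < u⁻¹ x.1

theorem mem_invSet : (p, q) ∈ invSet u ↔ p < q ∧ u⁻¹ q < u⁻¹ p := by
  simp [invSet]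

theorem inv_mul_swap_apply : (u * swap i j)⁻¹ p = swap i j (u⁻¹ p) := by
  simp [mul_inv_rev]

theorem inv_swap_mul_apply : (swap p q * u)⁻¹ k = u⁻¹ (swap p q k) := by
  simp [mul_inv_rev]

theorem invSet_mul_swap (hij : (i : ℕ) + 1 = j) (h : u i < u j) :
    invSet (u * swap i j) = insert (u i, u j) (invSet u) := by
  have hlt : i < j := by rw [Fin.lt_def]; omega
  ext ⟨p, q⟩
  simp only [Finset.mem_insert, mem_invSet, inv_mul_swap_apply, Prod.mk.injEq]
  constructor
  · rintro ⟨h1, h2⟩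
    by_cases h3 : swap i j (u⁻¹ q) = i ∧ swap i j (u⁻¹ p) = j
    · left
      rw [swap_apply_eq_iff, swap_apply_eq_iff, swap_apply_left, swap_apply_right] at h3
      simp [← h3.1, ← h3.2]
    · right
      have := swap_lt_swap_of_adjacent hij h2 h3
      rw [swap_apply_self, swap_apply_self] at this
      exact ⟨h1, this⟩
  · rintro (⟨rfl, rfl⟩ | ⟨h1, h2⟩)
    · simp [h, hlt]
    · refine ⟨h1, swap_lt_swap_of_adjacent hij h2 ?_⟩
      rintro ⟨rfl, rfl⟩
      rw [perm_apply_inv, perm_apply_inv] at h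
      exact h.asymm h1

theorem card_invSet_mul_swap (hij : (i : ℕ) + 1 = j) (h : u i < u j) :
    (invSet (u * swap i j)).card = (invSet u).card + 1 := by
  have hlt : i < j := by rw [Fin.lt_def]; omega
  rw [invSet_mul_swap hij h, Finset.card_insert_of_notMem]
  simp [mem_invSet, hlt.le]

theorem invSet_one : invSet (1 : Perm (Fin n)) = ∅ := by
  ext ⟨p, q⟩
  simp only [mem_invSet, inv_one, Perm.coe_one, id, Finset.notMem_empty, iff_false, not_and]
  exact fun h => h.asymm

theorem card_invSet_prod_le (l : List (Perm (Fin n))) (hl : ∀ s ∈ l, IsSimpleReflection s) :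
    (invSet l.prod).card ≤ l.length := by
  induction l using List.reverseRecOn with
  | nil => simp [invSet_one]
  | append_singleton l s ih =>
    have h1 := ih fun t ht => hl t (by simp [ht])
    obtain ⟨i, j, hij, rfl⟩ := hl s (by simp)
    rw [List.prod_append, List.prod_singleton, List.length_append, List.length_singleton]
    rcases lt_trichotomy (l.prod i) (l.prod j) with h | h | h
    · rw [card_invSet_mul_swap hij h]
      omega
    · have := l.prod.injective h
      subst this
      omega
    · have := card_invSet_mul_swap (u := l.prod * swap i j) hij (by simpa using h)
      rw [mul_swap_mul_self] at this
      omega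

theorem exists_word (u : Perm (Fin n)) : ∃ l : List (Perm (Fin n)),
    l.length = (invSet u).card ∧ (∀ s ∈ l, IsSimpleReflection s) ∧ l.prod = u := by
  induction hm : (invSet u).card generalizing u with
  | zero =>
    refine ⟨[], rfl, by simp, ?_⟩
    rw [List.prod_nil, eq_comm]
    refine eq_one_of_adjacent fun i j hij => ?_
    have hlt : i < j := by rw [Fin.lt_def]; omega
    by_contra h
    have h' : u j < u i := lt_of_le_of_ne (not_lt.1 h) (u.injective.ne hlt.ne')
    rw [Finset.card_eq_zero] at hm
    have : (u j, u i) ∈ invSet u := by simp [mem_invSet, h', hlt]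
    simp [hm] at this
  | succ m ih =>
    obtain ⟨i, j, hij, h⟩ : ∃ i j : Fin n, (i : ℕ) + 1 = j ∧ u j < u i := by
      by_contra! h
      have : u = 1 := eq_one_of_adjacent fun i j hij => by
        have hlt : i < j := by rw [Fin.lt_def]; omega
        exact lt_of_le_of_ne (h i j hij) (u.injective.ne hlt.ne)
      rw [this, invSet_one] at hm
      simp at hm
    have h1 := card_invSet_mul_swap (u := u * swap i j) hij (by simpa using h)
    rw [mul_swap_mul_self, hm] at h1
    obtain ⟨l, hl, hs, hp⟩ := ih (u * swap i j) (by omega)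
    refine ⟨l ++ [swap i j], by simp [hl], ?_, by simp [hp]⟩
    intro s hs'
    rcases List.mem_append.1 hs' with h2 | h2
    · exact hs s h2
    · rw [List.mem_singleton.1 h2]
      exact ⟨i, j, hij, rfl⟩

/-- Each letter of a word adds at most one inversion, while removing descents one at a time yields a
word with exactly as many letters as inversions. -/
theorem length_eq_card_invSet (u : Perm (Fin n)) : length u = (invSet u).card := by
  obtain ⟨l, hl, hs, hp⟩ := exists_word u
  refine le_antisymm (Nat.sInf_le ⟨l, hl, hs, hp⟩) ?_
  refine le_csInf ⟨_, l, hl, hs, hp⟩ ?_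
  rintro m ⟨l, rfl, hs, rfl⟩
  exact card_invSet_prod_le l hs

theorem length_mul_swap (hij : (i : ℕ) + 1 = j) (h : u i < u j) :
    length (u * swap i j) = length u + 1 := by
  rw [length_eq_card_invSet, length_eq_card_invSet, card_invSet_mul_swap hij h]

theorem length_mul_swap_lt_iff (hij : (i : ℕ) + 1 = j) :
    length (u * swap i j) < length u ↔ u j < u i := by
  have hlt : i < j := by rw [Fin.lt_def]; omega
  rcases lt_or_gt_of_ne (u.injective.ne hlt.ne) with h | h
  · have := length_mul_swap hij h
    constructor
    · omega
    · exact fun h' => absurd h' h.asymm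
  · have := length_mul_swap (u := u * swap i j) hij (by simpa using h)
    rw [mul_swap_mul_self] at this
    simp only [h, iff_true]
    omega

theorem length_inv (u : Perm (Fin n)) : length u⁻¹ = length u := by
  rw [length_eq_card_invSet, length_eq_card_invSet]
  refine Finset.card_bij (fun x _ => (u x.2, u x.1)) ?_ ?_ ?_
  · rintro ⟨p, q⟩ h
    rw [mem_invSet] at h
    simpa [mem_invSet, and_comm] using h
  · rintro ⟨p, q⟩ _ ⟨p', q'⟩ _ h
    simpa [and_comm] using h
  · rintro ⟨p, q⟩ h
    rw [mem_invSet] at h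
    exact ⟨(u⁻¹ q, u⁻¹ p), by simpa [mem_invSet, and_comm] using h, by simp⟩

theorem length_swap_mul (hk : (k : ℕ) + 1 = k') (h : u⁻¹ k < u⁻¹ k') :
    length (swap k k' * u) = length u + 1 := by
  rw [← length_inv, mul_inv_rev, swap_inv, length_mul_swap hk h, length_inv]

/-- Containment of inversion sets implies comparability in right weak order. -/
theorem weakLE_of_invSet_subset (h : invSet y ⊆ invSet z) : weakLE y z := by
  induction hm : (invSet z \ invSet y).card using Nat.strong_induction_on generalizing y with
  | _ m ih =>
    by_cases hyz : y = z
    · rw [hyz]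
      exact Relation.ReflTransGen.refl
    -- If `z⁻¹ * y` preserved the order of all adjacent positions it would be the identity. The pair
    -- found is an inversion of `z` but not of `y`, so swapping it moves `y` one cover up, still
    -- below `z`.
    obtain ⟨i, j, hij, hlt⟩ : ∃ i j : Fin n, (i : ℕ) + 1 = j ∧ z⁻¹ (y j) < z⁻¹ (y i) := by
      by_contra! hc
      have : z⁻¹ * y = 1 := eq_one_of_adjacent fun i j hij => by
        have hlt : i < j := by rw [Fin.lt_def]; omega
        refine lt_of_le_of_ne (hc i j hij) ?_
        exact (z⁻¹ * y).injective.ne hlt.ne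
      exact hyz (inv_mul_eq_one.1 this).symm
    have hij' : i < j := by rw [Fin.lt_def]; omega
    have hy : y i < y j := by
      by_contra hy
      have h1 : (y j, y i) ∈ invSet y := by
        simp [mem_invSet, hij', lt_of_le_of_ne (not_lt.1 hy) (y.injective.ne hij'.ne')]
      exact (mem_invSet.1 (h h1)).2.asymm hlt
    have hmem : (y i, y j) ∈ invSet z := mem_invSet.2 ⟨hy, hlt⟩
    have hnot : (y i, y j) ∉ invSet y := by simp [mem_invSet, hij'.le]
    have hsub : invSet (y * swap i j) ⊆ invSet z := by
      rw [invSet_mul_swap hij hy]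
      exact Finset.insert_subset hmem h
    refine Relation.ReflTransGen.head ⟨swap i j, ⟨i, j, hij, rfl⟩, rfl, length_mul_swap hij hy⟩
      (ih _ ?_ hsub rfl)
    rw [← hm]
    refine Finset.card_lt_card ⟨?_, fun hs => ?_⟩
    · rw [invSet_mul_swap hij hy]
      exact Finset.sdiff_subset_sdiff subset_rfl (Finset.subset_insert _ _)
    · have := hs (Finset.mem_sdiff.2 ⟨hmem, hnot⟩)
      rw [invSet_mul_swap hij hy] at this
      simp at this

/-! ### Bruhat order -/

theorem bruhatLE.trans (h1 : bruhatLE u v) (h2 : bruhatLE v w) : bruhatLE u w :=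
  Relation.ReflTransGen.trans h1 h2

theorem bruhatLE_refl (u : Perm (Fin n)) : bruhatLE u u := Relation.ReflTransGen.refl

theorem bruhatLE.length_le (h : bruhatLE u v) : length u ≤ length v := by
  induction h with
  | refl => exact le_rfl
  | tail _ h ih =>
    obtain ⟨t, -, -, h⟩ := h
    omega

theorem mul_swap_conj {i m j : Fin n} (hmj : m ≠ j) (hij : i ≠ j)
    (u : Perm (Fin n)) : u * swap i m * swap m j * swap i m = u * swap i j := by
  have h : swap i m * swap m j * swap i m = swap i j := by
    rw [swap_comm i m, swap_comm m j, swap_mul_swap_mul_swap hmj.symm hij.symm]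
  rw [mul_assoc, mul_assoc, ← mul_assoc (swap i m), h]

/-- Write `(i j) = (i m)(m j)(i m)` with `m = i + 1`. As `u m` is not between `u i` and `u j`, the
two outer factors change the length by opposite amounts, and the middle one adds 1 by induction. -/
theorem length_mul_swap_of_no_between (hij : i < j) (h : u i < u j)
    (hno : ∀ m, i < m → m < j → ¬ (u i < u m ∧ u m < u j)) :
    length (u * swap i j) = length u + 1 := by
  induction hd : (j : ℕ) - i using Nat.strong_induction_on generalizing u i with
  | _ D ih =>
    by_cases hadj : (i : ℕ) + 1 = j
    · exact length_mul_swap hadj h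
    have hij' := Fin.lt_def.1 hij
    obtain ⟨m, hm⟩ : ∃ m : Fin n, (i : ℕ) + 1 = m := ⟨⟨i + 1, by omega⟩, rfl⟩
    have him : i < m := by rw [Fin.lt_def]; omega
    have hmj : m < j := by rw [Fin.lt_def]; omega
    have h1 : length (u * swap i m * swap m j) = length (u * swap i m) + 1 := by
      refine ih (j - m) (by omega) hmj ?_ ?_ rfl
      · simpa [swap_apply_of_ne_of_ne hij.ne' hmj.ne'] using h
      · intro x hx hxj
        have := hno x (him.trans hx) hxj
        simpa [swap_apply_of_ne_of_ne hij.ne' hmj.ne',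
          swap_apply_of_ne_of_ne (him.trans hx).ne' hx.ne'] using this
    have e1 : (u * swap i m * swap m j) i = u m := by
      simp [swap_apply_of_ne_of_ne him.ne hij.ne]
    have e2 : (u * swap i m * swap m j) m = u j := by
      simp [swap_apply_of_ne_of_ne hij.ne' hmj.ne']
    have hconj := mul_swap_conj hmj.ne hij.ne u
    rcases lt_or_gt_of_ne (u.injective.ne him.ne) with h2 | h2
    · have h3 : u j < u m :=
        lt_of_le_of_ne (not_lt.1 fun h4 => hno m him hmj ⟨h2, h4⟩) (u.injective.ne hmj.ne')
      have h4 := length_mul_swap hm h2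
      have h5 := length_mul_swap (u := u * swap i j) hm (by
        rw [← hconj]
        simpa [e1, e2, swap_apply_of_ne_of_ne hij.ne' hmj.ne',
          swap_apply_of_ne_of_ne him.ne hij.ne] using h3)
      rw [← hconj, mul_swap_mul_self, hconj] at h5
      omega
    · have h4 := length_mul_swap (u := u * swap i m) hm (by simpa using h2)
      rw [mul_swap_mul_self] at h4
      have h5 := length_mul_swap (u := u * swap i m * swap m j) hm (by
        rw [e1, e2]
        exact h2.trans h)
      rw [hconj] at h5
      omega

/-- A value between `u i` and `u j` at an intermediate position `m` splits the swap into three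
shorter ones, each going up; if there is none, the swap is a cover. -/
theorem bruhatLE_mul_swap (hij : i < j) (h : u i < u j) : bruhatLE u (u * swap i j) := by
  induction hd : (j : ℕ) - i using Nat.strong_induction_on generalizing u i j with
  | _ D ih =>
    by_cases hno : ∀ m, i < m → m < j → ¬ (u i < u m ∧ u m < u j)
    · exact Relation.ReflTransGen.single
        ⟨swap i j, ⟨i, j, hij.ne, rfl⟩, rfl, length_mul_swap_of_no_between hij h hno⟩
    push Not at hno
    obtain ⟨m, him, hmj, h1, h2⟩ := hno
    have him' := Fin.lt_def.1 him
    have hmj' := Fin.lt_def.1 hmj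
    rw [← mul_swap_conj hmj.ne hij.ne]
    refine (ih (m - i) (by omega) him h1 rfl).trans
      ((ih (j - m) (by omega) hmj ?_ rfl).trans (ih (m - i) (by omega) him ?_ rfl))
    · simpa [swap_apply_of_ne_of_ne hij.ne' hmj.ne'] using h
    · simpa [swap_apply_of_ne_of_ne hij.ne' hmj.ne', swap_apply_of_ne_of_ne him.ne hij.ne] using h2

theorem swap_mul_eq_mul_swap : swap p q * u = u * swap (u⁻¹ p) (u⁻¹ q) := by
  rw [mul_swap_eq_swap_mul, perm_apply_inv, perm_apply_inv]

theorem bruhatLE_swap_mul (hpq : p < q) (h : u⁻¹ p < u⁻¹ q) : bruhatLE u (swap p q * u) := by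
  rw [swap_mul_eq_mul_swap]
  exact bruhatLE_mul_swap h (by simpa using hpq)

theorem bruhatLE_swap_mul_swap_mul (hk : (k : ℕ) + 1 = k') (hpq : p < q) (h : u⁻¹ p < u⁻¹ q)
    (hne : ¬ (p = k ∧ q = k')) : bruhatLE (swap k k' * u) (swap k k' * (swap p q * u)) := by
  have h1 : swap k k' * (swap p q * u) = swap (swap k k' p) (swap k k' q) * (swap k k' * u) := by
    rw [← mul_assoc, mul_swap_eq_swap_mul, mul_assoc]
  rw [h1]
  refine bruhatLE_swap_mul (swap_lt_swap_of_adjacent hk hpq hne) ?_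
  simpa [inv_swap_mul_apply] using h

theorem exists_swap_of_cover {t : Perm (Fin n)} (ht : t.IsSwap)
    (hl : length (u * t) = length u + 1) :
    ∃ p q, p < q ∧ u⁻¹ p < u⁻¹ q ∧ u * t = swap p q * u := by
  obtain ⟨i, j, hij, rfl⟩ : ∃ i j : Fin n, i < j ∧ t = swap i j := by
    obtain ⟨i, j, hij, rfl⟩ := ht
    rcases lt_or_gt_of_ne hij with h | h
    · exact ⟨i, j, h, rfl⟩
    · exact ⟨j, i, h, swap_comm _ _⟩
  have h : u i < u j := by
    by_contra h
    have h1 := lt_of_le_of_ne (not_lt.1 h) (u.injective.ne hij.ne')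
    have h2 := (bruhatLE_mul_swap (u := u * swap i j) hij (by simpa using h1)).length_le
    rw [mul_swap_mul_self] at h2
    omega
  exact ⟨u i, u j, h, by simpa using hij, mul_swap_eq_swap_mul _ _ _⟩

/-- The smaller of `u` and `s u`, for `s` the transposition of the adjacent values `k`, `k'`. -/
def lower (k k' : Fin n) (u : Perm (Fin n)) : Perm (Fin n) :=
  if u⁻¹ k < u⁻¹ k' then u else swap k k' * u

/-- The larger of `u` and `s u`, for `s` the transposition of the adjacent values `k`, `k'`. -/
def raise (k k' : Fin n) (u : Perm (Fin n)) : Perm (Fin n) :=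
  if u⁻¹ k < u⁻¹ k' then swap k k' * u else u

theorem swap_mul_bruhatLE (hk : (k : ℕ) + 1 = k') (h : ¬ u⁻¹ k < u⁻¹ k') :
    bruhatLE (swap k k' * u) u := by
  have hlt : k < k' := by rw [Fin.lt_def]; omega
  have h1 : u⁻¹ k' < u⁻¹ k := lt_of_le_of_ne (not_lt.1 h) ((u⁻¹).injective.ne hlt.ne')
  have := bruhatLE_swap_mul (u := swap k k' * u) hlt (by simpa [inv_swap_mul_apply] using h1)
  rwa [swap_mul_self_mul] at this

/-- The lifting property. It suffices to treat a cover `y < (p q) y`. Left multiplication by `(k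
k')` keeps it going up unless `(p, q) = (k, k')`, and then both ends have the same `lower` and the
same `raise`. -/
theorem bruhatLE.lower_raise (hk : (k : ℕ) + 1 = k') (h : bruhatLE u v) :
    bruhatLE (lower k k' u) (lower k k' v) ∧ bruhatLE (raise k k' u) (raise k k' v) := by
  have hlt : k < k' := by rw [Fin.lt_def]; omega
  induction h with
  | refl => exact ⟨bruhatLE_refl _, bruhatLE_refl _⟩
  | @tail y y' _ h ih =>
    obtain ⟨t, ht, rfl, hl⟩ := h
    obtain ⟨p, q, hpq, hu, he⟩ := exists_swap_of_cover ht hl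
    rw [he]
    suffices h : bruhatLE (lower k k' y) (lower k k' (swap p q * y)) ∧
        bruhatLE (raise k k' y) (raise k k' (swap p q * y)) from
      ⟨ih.1.trans h.1, ih.2.trans h.2⟩
    by_cases hpk : p = k ∧ q = k'
    · obtain ⟨rfl, rfl⟩ := hpk
      have h1 : ¬ (swap p q * y)⁻¹ p < (swap p q * y)⁻¹ q := by
        simpa [inv_swap_mul_apply] using hu.le
      simp only [lower, raise, if_pos hu, if_neg h1, swap_mul_self_mul]
      exact ⟨bruhatLE_refl _, bruhatLE_refl _⟩
    · have h1 := bruhatLE_swap_mul_swap_mul hk hpq hu hpk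
      have h2 := bruhatLE_swap_mul hpq hu
      by_cases h3 : y⁻¹ k < y⁻¹ k'
      · have h4 := bruhatLE_swap_mul hlt h3
        by_cases h5 : (swap p q * y)⁻¹ k < (swap p q * y)⁻¹ k'
        · simp only [lower, raise, if_pos h3, if_pos h5]
          exact ⟨h2, h1⟩
        · simp only [lower, raise, if_pos h3, if_neg h5]
          exact ⟨h4.trans h1, h1.trans (swap_mul_bruhatLE hk h5)⟩
      · have h4 := swap_mul_bruhatLE hk h3
        by_cases h5 : (swap p q * y)⁻¹ k < (swap p q * y)⁻¹ k'
        · simp only [lower, raise, if_neg h3, if_pos h5]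
          exact ⟨h4.trans h2, h2.trans (bruhatLE_swap_mul hlt h5)⟩
        · simp only [lower, raise, if_neg h3, if_neg h5]
          exact ⟨h1, h2⟩

theorem bruhatLE_one_iff : bruhatLE u 1 ↔ u = 1 := by
  constructor
  · intro h
    have h1 := h.length_le
    rw [length_eq_card_invSet, length_eq_card_invSet, invSet_one, Finset.card_empty,
      Nat.le_zero] at h1
    obtain ⟨l, hl, -, hp⟩ := exists_word u
    rw [h1, List.length_eq_zero_iff] at hl
    rw [← hp, hl, List.prod_nil]
  · rintro rfl
    exact bruhatLE_refl _

theorem bruhatLE.swap_mul_right (hk : (k : ℕ) + 1 = k') (hw : w⁻¹ k < w⁻¹ k')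
    (h : bruhatLE v w) : bruhatLE v (swap k k' * w) :=
  h.trans (bruhatLE_swap_mul (by rw [Fin.lt_def]; omega) hw)

theorem bruhatLE.swap_mul_both (hk : (k : ℕ) + 1 = k') (hw : w⁻¹ k < w⁻¹ k')
    (h : bruhatLE v w) : bruhatLE (swap k k' * v) (swap k k' * w) := by
  have h1 := (h.lower_raise hk).2
  rw [raise, raise, if_pos hw] at h1
  split_ifs at h1 with h2
  · exact h1
  · exact (swap_mul_bruhatLE hk h2).trans h1

/-- Together with `bruhatLE.swap_mul_right` and `bruhatLE.swap_mul_both` this gives `[e, sw] = [e,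
w] ∪ s[e, w]`, the recursion behind the construction of the fan. -/
theorem bruhatLE_swap_mul_cases (hk : (k : ℕ) + 1 = k') (hw : w⁻¹ k < w⁻¹ k')
    (h : bruhatLE v (swap k k' * w)) : bruhatLE v w ∨ bruhatLE (swap k k' * v) w := by
  have h1 := (h.lower_raise hk).1
  have h2 : ¬ (swap k k' * w)⁻¹ k < (swap k k' * w)⁻¹ k' := by
    simpa [inv_swap_mul_apply] using hw.le
  rw [lower, lower, if_neg h2, swap_mul_self_mul] at h1
  split_ifs at h1
  · exact Or.inl h1
  · exact Or.inr h1

end Bruhat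

/-! ### The partial orders describing the normal fan of `Q_w` -/

section FanPoset

variable {n : ℕ} {u v w : Perm (Fin n)} {k k' p q : Fin n} {a : Fin n → ℝ}
  {P : Fin n → Fin n → Prop}

/-- The value of the functional `a` at the vector of `v`. -/
def pairing (a : Fin n → ℝ) (v : Perm (Fin n)) : ℝ :=
  ∑ i, a i * ((((v⁻¹ i : Fin n) : ℕ) : ℝ) + 1)

theorem pairing_swap_mul (a : Fin n → ℝ) (v : Perm (Fin n)) (p q : Fin n) :
    pairing a (swap p q * v) = pairing a v +
      (a p - a q) * ((((v⁻¹ q : Fin n) : ℕ) : ℝ) - (((v⁻¹ p : Fin n) : ℕ) : ℝ)) := by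
  by_cases hpq : p = q
  · subst hpq
    simp [swap_self, ← Perm.one_def]
  rw [← sub_eq_iff_eq_add', pairing, pairing, ← Finset.sum_sub_distrib,
    ← Finset.sum_subset (Finset.subset_univ {p, q}), Finset.sum_pair hpq]
  · rw [inv_swap_mul_apply, inv_swap_mul_apply, swap_apply_left, swap_apply_right]
    ring
  · intro x _ hx
    simp only [Finset.mem_insert, Finset.mem_singleton, not_or] at hx
    rw [inv_swap_mul_apply, swap_apply_of_ne_of_ne hx.1 hx.2, sub_self]

theorem pairing_comp_swap (a : Fin n → ℝ) (v : Perm (Fin n)) (p q : Fin n) :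
    pairing (fun x => a (swap p q x)) v = pairing a (swap p q * v) := by
  rw [pairing, pairing, ← Equiv.sum_comp (swap p q)]
  simp only [swap_apply_self, inv_swap_mul_apply]

/-- `P` is the partial order whose order cone is the normal cone of `Q_w` at `u`. -/
structure FanPoset (w u : Perm (Fin n)) (P : Fin n → Fin n → Prop) : Prop where
  trans : ∀ x y z, P x y → P y z → P x z
  lt : ∀ x y, P x y → u⁻¹ x < u⁻¹ y
  cover : ∀ x y, P x y → (∃ m, P x m ∧ P m y) ∨ bruhatLE (swap x y * u) w
  inv : ∀ x y, y < x → u⁻¹ x < u⁻¹ y → P x y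
  -- `split` is what makes the order of the maximal extension transitive. `below` and `above` ensure
  -- that a cover `p ⋖ q` with `p < q` occupies consecutive positions in that extension.
  split : ∀ x y z, x < y → y < z → P x z → P x y ∨ P y z
  below : ∀ x y z, x < y → y < z → P x z → P y z → P x y ∨ ∃ m, P y m ∧ P m z
  above : ∀ x y z, x < y → y < z → P x y → P x z → P y z ∨ ∃ m, P x m ∧ P m y
  max : ∀ a : Fin n → ℝ, (∀ x y, P x y → a x < a y) →
    ∀ v, bruhatLE v w → v ≠ u → pairing a v < pairing a u

theorem fanPoset_one : FanPoset (1 : Perm (Fin n)) 1 fun _ _ => False where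
  trans := by simp
  lt := by simp
  cover := by simp
  inv := fun x y h1 h2 => (h1.asymm (by simpa using h2)).elim
  split := by simp
  below := by simp
  above := by simp
  max := fun a _ v hv hne => absurd (bruhatLE_one_iff.1 hv) hne

/-- The transitive closure of `P` and the relation `k < k'`. -/
def addRel (k k' : Fin n) (P : Fin n → Fin n → Prop) (x y : Fin n) : Prop :=
  P x y ∨ (x = k ∨ P x k) ∧ (y = k' ∨ P k' y)

/-- Inductive step at a vertex `u ≤ w` with `k` before `k'`. The one possible new cover is `k ⋖ k'`,
whose neighbour `su` lies below `sw`. -/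
theorem FanPoset.addRel (hk : (k : ℕ) + 1 = k') (hw : w⁻¹ k < w⁻¹ k') (hu : u⁻¹ k < u⁻¹ k')
    (huw : bruhatLE u w) (h : FanPoset w u P) :
    FanPoset (swap k k' * w) u (addRel k k' P) := by
  have hkk : k < k' := by rw [Fin.lt_def]; omega
  have hA : ∀ y : Fin n, y < k ∨ y = k ∨ y = k' ∨ k' < y := by
    intro y
    simp only [Fin.lt_def, Fin.ext_iff]
    omega
  have htr := h.trans
  have hlt := h.lt
  have hcov := h.cover
  have hspl := h.split
  have hbel := h.below
  have habv := h.above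
  -- If `k` already precedes `k'` in `P`, nothing is added.
  have hold' : P k k' → ∀ {x y}, P x y ∨ (x = k ∨ P x k) ∧ (y = k' ∨ P k' y) → P x y := by
    rintro hold x y (h | ⟨rfl | h1, rfl | h2⟩)
    exacts [h, hold, htr _ _ _ hold h2, htr _ _ _ h1 hold, htr _ _ _ h1 (htr _ _ _ hold h2)]
  refine ⟨?_, ?_, ?_, ?_, ?_, ?_, ?_, ?_⟩
  · unfold BruhatPolytope.addRel
    grind
  · unfold BruhatPolytope.addRel
    grind
  · unfold BruhatPolytope.addRel
    rintro x y (hxy | ⟨hx, hy⟩)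
    · rcases hcov x y hxy with ⟨m, hm⟩ | h1
      · exact Or.inl ⟨m, Or.inl hm.1, Or.inl hm.2⟩
      · exact Or.inr (h1.swap_mul_right hk hw)
    · rcases hx with rfl | hx
      · rcases hy with rfl | hy
        · exact Or.inr (huw.swap_mul_both hk hw)
        · exact Or.inl ⟨k', Or.inr ⟨Or.inl rfl, Or.inl rfl⟩, Or.inl hy⟩
      · exact Or.inl ⟨k, Or.inl hx, Or.inr ⟨Or.inl rfl, hy⟩⟩
  · exact fun x y h1 h2 => Or.inl (h.inv x y h1 h2)
  · unfold BruhatPolytope.addRel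
    intro x y z hxy hyz hxz
    have := hA y
    have := hspl x y z
    have := hspl x y k
    have := hspl k' y z
    clear h hlt hcov hspl hbel habv hold' hA
    grind
  · unfold BruhatPolytope.addRel
    intro x y z hxy hyz hxz hyz'
    by_cases hold : P k k'
    · rcases hbel x y z hxy hyz (hold' hold hxz) (hold' hold hyz') with h1 | ⟨m, h1, h2⟩
      · exact Or.inl (Or.inl h1)
      · exact Or.inr ⟨m, Or.inl h1, Or.inl h2⟩
    have := hA y
    have := hspl x y k
    have := hspl x k k'
    have := hbel x y z
    have := hbel k' y z
    clear h hlt hcov hspl hbel habv hold' hA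
    grind
  · unfold BruhatPolytope.addRel
    intro x y z hxy hyz hxy' hxz
    by_cases hold : P k k'
    · rcases habv x y z hxy hyz (hold' hold hxy') (hold' hold hxz) with h1 | ⟨m, h1, h2⟩
      · exact Or.inl (Or.inl h1)
      · exact Or.inr ⟨m, Or.inl h1, Or.inl h2⟩
    have := hA y
    have := hspl k' y z
    have := hspl k k' z
    have := habv x y z
    have := habv x y k
    clear h hlt hcov hspl hbel habv hold' hA
    grind
  · intro a ha v hv hne
    have ha' : a k < a k' := ha k k' (Or.inr ⟨Or.inl rfl, Or.inl rfl⟩)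
    have hmax := h.max a fun x y hxy => ha x y (Or.inl hxy)
    have hle : ∀ v, bruhatLE v w → pairing a v ≤ pairing a u := by
      intro v hv
      by_cases hvu : v = u
      · rw [hvu]
      · exact (hmax v hv hvu).le
    by_cases hvw : bruhatLE v w
    · exact hmax v hvw hne
    -- A new vertex `v` has `sv ≤ w` and `k'` before `k`. Since `a k < a k'`, passing from `v` to
    -- `sv` strictly raises the pairing, which is already at most that of `u`.
    have h1 := (bruhatLE_swap_mul_cases hk hw hv).resolve_left hvw
    have h2 : v⁻¹ k' < v⁻¹ k := by
      by_contra h2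
      refine hvw ((bruhatLE_swap_mul hkk ?_).trans h1)
      exact lt_of_le_of_ne (not_lt.1 h2) ((v⁻¹).injective.ne hkk.ne)
    have h3 := hle _ h1
    rw [pairing_swap_mul] at h3
    have h4 : (((v⁻¹ k' : Fin n) : ℕ) : ℝ) < (((v⁻¹ k : Fin n) : ℕ) : ℝ) := by
      exact_mod_cast Fin.lt_def.1 h2
    nlinarith

/-- An interval stable under left multiplication by `s` has a normal fan symmetric under exchanging
coordinates `k` and `k'`. The axioms that compare labels transfer because `s` changes the order of
no other pair; for `k`, `k'` themselves `P k k'` replaces the axiom. -/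
theorem FanPoset.swap_mul (hk : (k : ℕ) + 1 = k') (hw : ∀ v, bruhatLE v w → bruhatLE (swap k k' * v) w)
    (h : FanPoset w u P) (hP : P k k') :
    FanPoset w (swap k k' * u) fun x y => P (swap k k' x) (swap k k' y) := by
  have hkk : k < k' := by rw [Fin.lt_def]; omega
  have hA : ∀ y : Fin n, y < k ∨ y = k ∨ y = k' ∨ k' < y := by
    intro y
    simp only [Fin.lt_def, Fin.ext_iff]
    omega
  have hsk : swap k k' k = k' := swap_apply_left _ _
  have hsk' : swap k k' k' = k := swap_apply_right _ _
  have hs : ∀ x y, x < y → ¬ (x = k ∧ y = k') → swap k k' x < swap k k' y :=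
    fun x y => swap_lt_swap_of_adjacent hk
  have hinv : ∀ x, swap k k' (swap k k' x) = x := swap_apply_self k k'
  have htr := h.trans
  refine ⟨fun x y z => h.trans _ _ _, ?_, ?_, ?_, ?_, ?_, ?_, ?_⟩
  · intro x y hxy
    simpa only [inv_swap_mul_apply] using h.lt _ _ hxy
  · intro x y hxy
    rcases h.cover _ _ hxy with ⟨m, h1, h2⟩ | h1
    · exact Or.inl ⟨swap k k' m, by rwa [hinv], by rwa [hinv]⟩
    · right
      have h2 := hw _ h1
      rwa [← mul_assoc, mul_swap_eq_swap_mul, hinv, hinv, mul_assoc] at h2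
  · intro x y hyx hxy
    simp only [inv_swap_mul_apply] at hxy
    by_cases hc : y = k ∧ x = k'
    · rw [hc.1, hc.2, hsk, hsk']
      exact hP
    · exact h.inv _ _ (hs y x hyx hc) hxy
  · intro x y z hxy hyz hxz
    by_cases h1 : x = k ∧ y = k'
    · right
      obtain ⟨rfl, rfl⟩ := h1
      rw [hsk] at hxz
      rw [hsk']
      exact htr _ _ _ hP hxz
    by_cases h2 : y = k ∧ z = k'
    · left
      obtain ⟨rfl, rfl⟩ := h2
      rw [hsk'] at hxz
      rw [hsk]
      exact htr _ _ _ hxz hP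
    exact h.split _ _ _ (hs x y hxy h1) (hs y z hyz h2) hxz
  · intro x y z hxy hyz hxz hyz'
    by_cases h1 : x = k ∧ y = k'
    · obtain ⟨rfl, rfl⟩ := h1
      rw [hsk] at hxz
      exact Or.inr ⟨x, by rwa [hsk, hsk'], by rwa [hsk]⟩
    by_cases h2 : y = k ∧ z = k'
    · obtain ⟨rfl, rfl⟩ := h2
      rw [hsk, hsk'] at hyz'
      exact absurd (h.lt _ _ hyz') (h.lt _ _ hP).asymm
    rcases h.below _ _ _ (hs x y hxy h1) (hs y z hyz h2) hxz hyz' with h3 | ⟨m, h3, h4⟩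
    · exact Or.inl h3
    · exact Or.inr ⟨swap k k' m, by rwa [hinv], by rwa [hinv]⟩
  · intro x y z hxy hyz hxy' hxz
    by_cases h1 : x = k ∧ y = k'
    · obtain ⟨rfl, rfl⟩ := h1
      rw [hsk, hsk'] at hxy'
      exact absurd (h.lt _ _ hxy') (h.lt _ _ hP).asymm
    by_cases h2 : y = k ∧ z = k'
    · obtain ⟨rfl, rfl⟩ := h2
      rw [hsk'] at hxz
      exact Or.inr ⟨z, by rwa [hsk'], by rwa [hsk, hsk']⟩
    rcases h.above _ _ _ (hs x y hxy h1) (hs y z hyz h2) hxy' hxz with h3 | ⟨m, h3, h4⟩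
    · exact Or.inl h3
    · exact Or.inr ⟨swap k k' m, by rwa [hinv], by rwa [hinv]⟩
  · intro a ha v hv hne
    have h1 := h.max (fun x => a (swap k k' x)) (fun x y hxy => ha _ _ (by rwa [hinv, hinv]))
      (swap k k' * v) (hw v hv) fun h2 => hne (by rw [← h2, swap_mul_self_mul])
    rwa [pairing_comp_swap, pairing_comp_swap, swap_mul_self_mul] at h1

/-- Every permutation is a linear extension of the poset of some `u` in the interval. -/
theorem exists_fanPoset (w x : Perm (Fin n)) : ∃ u, bruhatLE u w ∧ ∃ P, FanPoset w u P ∧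
    ∀ p q, P p q → x⁻¹ p < x⁻¹ q := by
  induction hm : length w using Nat.strong_induction_on generalizing w x with
  | _ m ih =>
    by_cases hw1 : ∃ k k' : Fin n, (k : ℕ) + 1 = k' ∧ w⁻¹ k' < w⁻¹ k
    · obtain ⟨k, k', hk, hwk⟩ := hw1
      have hkk : k < k' := by rw [Fin.lt_def]; omega
      obtain ⟨w, rfl⟩ : ∃ y, w = swap k k' * y := ⟨swap k k' * w, by rw [swap_mul_self_mul]⟩
      rw [inv_swap_mul_apply, inv_swap_mul_apply, swap_apply_left, swap_apply_right] at hwk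
      have hl := length_swap_mul hk hwk
      -- Here `u` must also have `k` before `k'`: otherwise the axiom `inv` would put `k'` below `k`
      -- in `P`, contrary to `x`. Hence `x` still extends the enlarged order.
      have key : ∀ x : Perm (Fin n), x⁻¹ k < x⁻¹ k' → ∃ u, bruhatLE u w ∧ ∃ P, P k k' ∧
          FanPoset (swap k k' * w) u P ∧ ∀ p q, P p q → x⁻¹ p < x⁻¹ q := by
        intro x hx
        obtain ⟨u, huw, P, hP, hPx⟩ := ih (length w) (by omega) w x rfl
        have hu : u⁻¹ k < u⁻¹ k' := by
          by_contra h
          have h1 := lt_of_le_of_ne (not_lt.1 h) ((u⁻¹).injective.ne hkk.ne')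
          exact (hPx _ _ (hP.inv k' k hkk h1)).asymm hx
        refine ⟨u, huw, _, Or.inr ⟨Or.inl rfl, Or.inl rfl⟩, hP.addRel hk hwk hu huw, ?_⟩
        unfold BruhatPolytope.addRel
        grind
      by_cases hx : x⁻¹ k < x⁻¹ k'
      · obtain ⟨u, huw, P, -, hP, hPx⟩ := key x hx
        exact ⟨u, huw.swap_mul_right hk hwk, P, hP, hPx⟩
      -- When `x` has `k'` before `k`, the case just settled is applied to `sx` and reflected by
      -- `s`.
      · have hx' : (swap k k' * x)⁻¹ k < (swap k k' * x)⁻¹ k' := by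
          rw [inv_swap_mul_apply, inv_swap_mul_apply, swap_apply_left, swap_apply_right]
          exact lt_of_le_of_ne (not_lt.1 hx) ((x⁻¹).injective.ne hkk.ne')
        obtain ⟨u, huw, P, hkP, hP, hPx⟩ := key _ hx'
        refine ⟨swap k k' * u, huw.swap_mul_both hk hwk, _, hP.swap_mul hk ?_ hkP, ?_⟩
        · intro v hv
          rcases bruhatLE_swap_mul_cases hk hwk hv with h | h
          · exact h.swap_mul_both hk hwk
          · exact h.swap_mul_right hk hwk
        · intro p q hpq
          have := hPx _ _ hpq
          rwa [inv_swap_mul_apply, inv_swap_mul_apply, swap_apply_self, swap_apply_self] at this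
    · push Not at hw1
      have : w⁻¹ = 1 := eq_one_of_adjacent fun i j hij => by
        have hlt : i < j := by rw [Fin.lt_def]; omega
        exact lt_of_le_of_ne (hw1 i j hij) ((w⁻¹).injective.ne hlt.ne)
      obtain rfl := inv_eq_one.1 this
      exact ⟨1, bruhatLE_refl _, _, fanPoset_one, by simp⟩

end FanPoset

end BruhatPolytope

/-- Send each element to its number of predecessors. -/
theorem exists_perm_of_strict_total {n : ℕ} (r : Fin n → Fin n → Prop) (hirr : ∀ x, ¬ r x x)
    (htrans : ∀ x y z, r x y → r y z → r x z) (htri : ∀ x y, x ≠ y → r x y ∨ r y x) :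
    ∃ z : Equiv.Perm (Fin n), ∀ x y, z⁻¹ x < z⁻¹ y ↔ r x y := by
  classical
  let f : Fin n → Fin n := fun x => ⟨(Finset.univ.filter fun y => r y x).card, by
    calc (Finset.univ.filter fun y => r y x).card < (Finset.univ : Finset (Fin n)).card := by
          refine Finset.card_lt_card (Finset.filter_ssubset.2 ⟨x, Finset.mem_univ _, hirr x⟩)
      _ = n := by simp⟩
  have hf : ∀ x y, r x y → f x < f y := by
    intro x y hxy
    change (Finset.univ.filter fun t => r t x).card < (Finset.univ.filter fun t => r t y).card
    refine Finset.card_lt_card ⟨fun t ht => ?_, fun hs => ?_⟩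
    · simp only [Finset.mem_filter, Finset.mem_univ, true_and] at ht ⊢
      exact htrans _ _ _ ht hxy
    · have := hs (Finset.mem_filter.2 ⟨Finset.mem_univ x, hxy⟩)
      exact hirr x (Finset.mem_filter.1 this).2
  have hinj : Function.Injective f := by
    intro x y hxy
    by_contra hne
    rcases htri x y hne with h | h
    · exact (hf _ _ h).ne hxy
    · exact (hf _ _ h).ne' hxy
  refine ⟨(Equiv.ofBijective f (Finite.injective_iff_bijective.1 hinj))⁻¹, fun x y => ?_⟩
  rw [inv_inv]
  refine ⟨fun h => ?_, hf x y⟩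
  have hne : x ≠ y := by
    rintro rfl
    exact lt_irrefl _ h
  exact (htri x y hne).resolve_right fun h' => (hf _ _ h').asymm h

namespace BruhatPolytope

open Equiv

/-! ### Maximal linear extensions and the map `Top_w` -/

section TopPerm

variable {n : ℕ} {u v w x y z : Perm (Fin n)} {i j p q : Fin n} {P : Fin n → Fin n → Prop}

/-- `z` is the linear extension of `P` with the most inversions. -/
def IsTopExtension (P : Fin n → Fin n → Prop) (z : Perm (Fin n)) : Prop :=
  ∀ p q, z⁻¹ p < z⁻¹ q ↔ P p q ∨ (q < p ∧ ¬ P q p)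

theorem FanPoset.asymm (h : FanPoset w u P) (hpq : P p q) : ¬ P q p :=
  fun hqp => (h.lt _ _ hpq).asymm (h.lt _ _ hqp)

theorem FanPoset.exists_isTopExtension (h : FanPoset w u P) : ∃ z, IsTopExtension P z := by
  refine exists_perm_of_strict_total _ ?_ ?_ ?_
  · rintro x (hx | hx)
    · exact h.asymm hx hx
    · exact lt_irrefl _ hx.1
  · have htr := h.trans
    have has : ∀ p q, P p q → ¬ P q p := fun p q => h.asymm
    intro x y z hxy hyz
    -- These are the three instances of `split` needed when at least one of the two steps is an
    -- inversion not forced by `P`.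
    have h1 := h.split x z y
    have h2 := h.split y x z
    have h3 := h.split z y x
    clear h
    grind
  · intro x y hxy
    rcases lt_or_gt_of_ne hxy with h1 | h1
    · by_cases h2 : P x y
      · exact Or.inl (Or.inl h2)
      · exact Or.inr (Or.inr ⟨h1, h2⟩)
    · by_cases h2 : P y x
      · exact Or.inr (Or.inl h2)
      · exact Or.inl (Or.inr ⟨h1, h2⟩)

theorem IsTopExtension.lt (hz : IsTopExtension P z) (h : P p q) : z⁻¹ p < z⁻¹ q :=
  (hz p q).2 (Or.inl h)

theorem IsTopExtension.weakLE (hz : IsTopExtension P z) (hy : ∀ p q, P p q → y⁻¹ p < y⁻¹ q) :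
    weakLE y z := by
  refine weakLE_of_invSet_subset ?_
  rintro ⟨p, q⟩ hpq
  obtain ⟨h1, h2⟩ := mem_invSet.1 hpq
  exact mem_invSet.2 ⟨h1, (hz q p).2 (Or.inr ⟨h1, fun h3 => (hy _ _ h3).asymm h2⟩)⟩

theorem IsTopExtension.rel_of_ascent (hz : IsTopExtension P z) (hij : (i : ℕ) + 1 = j)
    (h : z i < z j) : P (z i) (z j) := by
  have hlt : i < j := by rw [Fin.lt_def]; omega
  have := (hz (z i) (z j)).1 (by simpa using hlt)
  exact this.resolve_right fun h1 => h1.1.asymm h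

theorem IsTopExtension.bruhatLE_of_ascent (hz : IsTopExtension P z) (hP : FanPoset w u P)
    (hij : (i : ℕ) + 1 = j) (h : z i < z j) : bruhatLE (swap (z i) (z j) * u) w := by
  rcases hP.cover _ _ (hz.rel_of_ascent hij h) with ⟨m, h1, h2⟩ | h1
  · have h3 := hz.lt h1
    have h4 := hz.lt h2
    rw [← Perm.mul_apply, inv_mul_cancel, Perm.one_apply, Fin.lt_def] at h3 h4
    omega
  · exact h1

/-- Converse to `rel_of_ascent`. If `r` followed `p` immediately in `z` without being `q`, the
axioms `above` and `below` would contradict the placement of `r` or insert an element between `p`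
and `q` in `P`. -/
theorem IsTopExtension.exists_ascent (hz : IsTopExtension P z) (hP : FanPoset w u P)
    (hpq : P p q) (hlt : p < q) (hcov : ∀ m, ¬ (P p m ∧ P m q)) :
    ∃ i j : Fin n, (i : ℕ) + 1 = j ∧ z i = p ∧ z j = q := by
  refine ⟨z⁻¹ p, z⁻¹ q, ?_, by simp, by simp⟩
  have h1 := hz.lt hpq
  rw [Fin.lt_def] at h1
  by_contra hne
  obtain ⟨r, hr⟩ : ∃ r, ((z⁻¹ r : Fin n) : ℕ) = (z⁻¹ p : Fin n) + 1 :=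
    ⟨z ⟨(z⁻¹ p : Fin n) + 1, by omega⟩, by simp⟩
  have h2 := (hz p r).1 (by rw [Fin.lt_def]; omega)
  have h3 := (hz r q).1 (by rw [Fin.lt_def]; omega)
  rcases h2 with h2 | ⟨h2, h2'⟩ <;> rcases h3 with h3 | ⟨h3, h3'⟩
  · exact hcov r ⟨h2, h3⟩
  · rcases hP.above p q r hlt h3 hpq h2 with h4 | ⟨m, h4⟩
    · exact h3' h4
    · exact hcov m h4
  · rcases hP.below r p q h2 hlt h3 hpq with h4 | ⟨m, h4⟩
    · exact h2' h4
    · exact hcov m h4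
  · exact lt_asymm hlt (h3.trans h2)

/-! ### Normal cones -/

theorem inner_permVec (a : EuclideanSpace ℝ (Fin n)) (v : Perm (Fin n)) :
    inner ℝ a (permVec v) = pairing a v := by
  rw [PiLp.inner_apply, pairing]
  refine Finset.sum_congr rfl fun i _ => ?_
  simp [permVec, mul_comm]

theorem permVec_apply (v : Perm (Fin n)) (p : Fin n) :
    permVec v p = (((v⁻¹ p : Fin n) : ℕ) : ℝ) + 1 := rfl

theorem permVec_lt_permVec_iff : permVec v p < permVec v q ↔ v⁻¹ p < v⁻¹ q := by
  rw [permVec_apply, permVec_apply, add_lt_add_iff_right, Nat.cast_lt, Fin.lt_def]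

theorem permVec_injective : Function.Injective (permVec (n := n)) := by
  intro u v h
  rw [← inv_inj]
  ext p
  have := congrArg (fun a : EuclideanSpace ℝ (Fin n) => a p) h
  simp only [permVec_apply] at this
  exact_mod_cast add_right_cancel this

theorem forall_inner_le_iff (a : EuclideanSpace ℝ (Fin n)) (b : ℝ) :
    (∀ x ∈ bruhatIntervalPolytope w, inner ℝ a x ≤ b) ↔ ∀ v, bruhatLE v w → pairing a v ≤ b := by
  constructor
  · intro h v hv
    rw [← inner_permVec]
    exact h _ (subset_convexHull ℝ _ ⟨v, hv, rfl⟩)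
  · intro h x hx
    have : bruhatIntervalPolytope w ⊆ {x | (innerSL ℝ a) x ≤ b} := by
      refine convexHull_min ?_ (convex_halfSpace_le (innerSL ℝ a).toLinearMap.isLinear _)
      rintro _ ⟨v, hv, rfl⟩
      change inner ℝ a (permVec v) ≤ b
      rw [inner_permVec]
      exact h v hv
    exact this hx

theorem mem_normalCone_iff {a : EuclideanSpace ℝ (Fin n)} :
    a ∈ normalCone w u ↔ ∀ v, bruhatLE v w → pairing a v ≤ pairing a u := by
  rw [← forall_inner_le_iff, ← inner_permVec]
  rfl

/-- For a cover, compare `u` with its neighbour `(p q)u` in the interval. Other relations are chains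
of covers, by induction on the gap between positions. -/
theorem FanPoset.monotone_of_maximal (h : FanPoset w u P) {a : Fin n → ℝ}
    (ha : ∀ v, bruhatLE v w → pairing a v ≤ pairing a u) (hpq : P p q) : a p ≤ a q := by
  induction hm : ((u⁻¹ q : Fin n) : ℕ) - (u⁻¹ p : Fin n) using Nat.strong_induction_on
    generalizing p q with
  | _ m ih =>
    have hlt := Fin.lt_def.1 (h.lt _ _ hpq)
    rcases h.cover _ _ hpq with ⟨r, h1, h2⟩ | h1
    · have h3 := Fin.lt_def.1 (h.lt _ _ h1)
      have h4 := Fin.lt_def.1 (h.lt _ _ h2)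
      exact (ih _ (by omega) h1 rfl).trans (ih _ (by omega) h2 rfl)
    · have h2 := ha _ h1
      rw [pairing_swap_mul] at h2
      have h3 : (((u⁻¹ p : Fin n) : ℕ) : ℝ) < (((u⁻¹ q : Fin n) : ℕ) : ℝ) := by exact_mod_cast hlt
      by_contra h4
      nlinarith

/-- Adding `ε • permVec u` makes `a` strictly `P`-monotone, so the axiom `max` applies; then `ε` is
made small. -/
theorem FanPoset.maximal_of_monotone (h : FanPoset w u P) {a : Fin n → ℝ}
    (ha : ∀ p q, P p q → a p ≤ a q) (hv : bruhatLE v w) : pairing a v ≤ pairing a u := by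
  have hadd : ∀ (ε : ℝ) (y : Perm (Fin n)),
      pairing (fun i => a i + ε * permVec u i) y = pairing a y + ε * pairing (permVec u) y := by
    intro ε y
    simp only [pairing, Finset.mul_sum, ← Finset.sum_add_distrib]
    exact Finset.sum_congr rfl fun i _ => by ring
  by_contra! hlt
  by_cases hvu : v = u
  · exact hlt.ne (by rw [hvu])
  set D := pairing a v - pairing a u
  set M := pairing (permVec u) u - pairing (permVec u) v
  have hD : 0 < D := sub_pos.2 hlt
  have hε : ∀ ε : ℝ, 0 < ε → D < ε * M := by
    intro ε hε
    have h1 := h.max (fun i => a i + ε * permVec u i) (fun p q hpq => by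
      have h2 := permVec_lt_permVec_iff.2 (h.lt _ _ hpq)
      have h3 := ha p q hpq
      have h4 := mul_lt_mul_of_pos_left h2 hε
      simp only
      linarith) v hv hvu
    rw [hadd, hadd] at h1
    simp only [D, M]
    linarith
  have hM : 0 < M := by
    have := hε 1 one_pos
    linarith
  -- At this `ε` the strict inequality reads `D < D`.
  have := hε (D / M) (div_pos hD hM)
  rw [div_mul_cancel₀ _ hM.ne'] at this
  exact lt_irrefl _ this

theorem FanPoset.braidCone_subset_iff (h : FanPoset w u P) :
    braidCone x ⊆ normalCone w u ↔ ∀ p q, P p q → x⁻¹ p < x⁻¹ q := by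
  constructor
  · intro hx p q hpq
    have h1 : permVec x ∈ braidCone x := fun i j hij => hij.le
    have h2 := h.monotone_of_maximal (mem_normalCone_iff.1 (hx h1)) hpq
    refine lt_of_le_of_ne ?_ ((x⁻¹).injective.ne fun h3 => ?_)
    · exact not_lt.1 fun h3 => (permVec_lt_permVec_iff.2 h3).not_ge h2
    · subst h3
      exact lt_irrefl _ (h.lt _ _ hpq)
  · intro hx a ha
    refine mem_normalCone_iff.2 fun v hv => h.maximal_of_monotone (fun p q hpq => ?_) hv
    exact ha p q (permVec_lt_permVec_iff.2 (hx p q hpq))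

/-- `permVec x` is strictly monotone for both orders, so its unique maximizer is both `u` and `u'`.
-/
theorem FanPoset.eq_of_linearExtension {u' : Perm (Fin n)} {P' : Fin n → Fin n → Prop}
    (h : FanPoset w u P) (h' : FanPoset w u' P') (hu : bruhatLE u w) (hu' : bruhatLE u' w)
    (hx : ∀ p q, P p q → x⁻¹ p < x⁻¹ q) (hx' : ∀ p q, P' p q → x⁻¹ p < x⁻¹ q) : u = u' := by
  by_contra hne
  have h1 := h.max (permVec x) (fun p q hpq => permVec_lt_permVec_iff.2 (hx p q hpq)) u' hu'
    (Ne.symm hne)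
  have h2 := h'.max (permVec x) (fun p q hpq => permVec_lt_permVec_iff.2 (hx' p q hpq)) u hu hne
  exact h1.asymm h2

theorem norm_permVec_eq (u v : Perm (Fin n)) : ‖permVec u‖ = ‖permVec v‖ := by
  rw [EuclideanSpace.norm_eq, EuclideanSpace.norm_eq]
  congr 1
  simp only [permVec_apply]
  rw [Equiv.sum_comp u⁻¹ (fun i => ‖((i : ℕ) : ℝ) + 1‖ ^ 2),
    Equiv.sum_comp v⁻¹ (fun i => ‖((i : ℕ) : ℝ) + 1‖ ^ 2)]

/-- All the points `permVec v` lie on one sphere, so this is the equality case of Cauchy–Schwarz. -/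
theorem pairing_permVec_lt (h : v ≠ u) : pairing (permVec u) v < pairing (permVec u) u := by
  rw [← inner_permVec, ← inner_permVec, real_inner_self_eq_norm_sq, sq]
  nth_rewrite 2 [norm_permVec_eq u v]
  refine lt_of_le_of_ne (real_inner_le_norm _ _) fun h1 => h ?_
  have h2 : ‖permVec u - permVec v‖ ^ 2 = 0 := by
    rw [norm_sub_sq_real, h1, norm_permVec_eq u v]
    ring
  exact permVec_injective (sub_eq_zero.1 (norm_eq_zero.1 (pow_eq_zero_iff two_ne_zero |>.1 h2))).symm

/-- Apply `exists_fanPoset` with `x = u`. The vertex it returns maximizes `permVec u` over the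
interval, so it is `u`. -/
theorem exists_fanPoset_of_bruhatLE (hu : bruhatLE u w) : ∃ P, FanPoset w u P := by
  obtain ⟨u', hu', P, hP, hPu⟩ := exists_fanPoset w u
  suffices h : u = u' from ⟨P, h ▸ hP⟩
  by_contra hne
  have h1 := hP.max (permVec u) (fun p q hpq => permVec_lt_permVec_iff.2 (hPu p q hpq)) u hu hne
  exact h1.asymm (pairing_permVec_lt (Ne.symm hne))

/-- A linear extension belongs to the order of only one vertex, so the vertex in the definition of
the class has no freedom. -/
theorem FanPoset.mem_fanClass_iff (h : FanPoset w u P) (hu : bruhatLE u w)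
    (hx : ∀ p q, P p q → x⁻¹ p < x⁻¹ q) :
    y ∈ fanClass w x ↔ ∀ p q, P p q → y⁻¹ p < y⁻¹ q := by
  constructor
  · rintro ⟨u', hu', h1, h2⟩
    obtain ⟨P', hP'⟩ := exists_fanPoset_of_bruhatLE hu'
    obtain rfl := h.eq_of_linearExtension hP' hu hu' hx (hP'.braidCone_subset_iff.1 h1)
    exact h.braidCone_subset_iff.1 h2
  · intro hy
    exact ⟨u, hu, h.braidCone_subset_iff.2 hx, h.braidCone_subset_iff.2 hy⟩

theorem FanPoset.isTop (h : FanPoset w u P) (hu : bruhatLE u w)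
    (hx : ∀ p q, P p q → x⁻¹ p < x⁻¹ q) (hz : IsTopExtension P z) : IsTop w x z :=
  ⟨(h.mem_fanClass_iff hu hx).2 fun _ _ => hz.lt,
    fun _ hy => hz.weakLE ((h.mem_fanClass_iff hu hx).1 hy)⟩

theorem weakLE.length_le (h : weakLE y z) : length y ≤ length z ∧ (length y = length z → y = z) := by
  induction h with
  | refl => exact ⟨le_rfl, fun _ => rfl⟩
  | tail _ h ih =>
    obtain ⟨s, -, -, h⟩ := h
    omega

theorem IsTop.unique {z' : Perm (Fin n)} (h : IsTop w x z) (h' : IsTop w x z') : z = z' := by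
  have h1 := (h.2 _ h'.1).length_le
  have h2 := (h'.2 _ h.1).length_le
  exact h2.2 (h2.1.antisymm h1.1)

theorem isTop_top (w x : Perm (Fin n)) : IsTop w x (Top w x) := by
  obtain ⟨u, hu, P, hP, hx⟩ := exists_fanPoset w x
  obtain ⟨z, hz⟩ := hP.exists_isTopExtension
  exact Classical.epsilon_spec ⟨z, hP.isTop hu hx hz⟩

theorem FanPoset.isTopExtension_top (h : FanPoset w u P) (hu : bruhatLE u w) :
    IsTopExtension P (Top w u) := by
  obtain ⟨z, hz⟩ := h.exists_isTopExtension
  rwa [(isTop_top w u).unique (h.isTop hu h.lt hz)]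

theorem top_injOn (w : Perm (Fin n)) : Set.InjOn (Top w) (lowerInterval w) := by
  intro u hu u' hu' h
  obtain ⟨P, hP⟩ := exists_fanPoset_of_bruhatLE hu
  obtain ⟨P', hP'⟩ := exists_fanPoset_of_bruhatLE hu'
  refine hP.eq_of_linearExtension hP' hu hu' (x := Top w u)
    (fun _ _ => (hP.isTopExtension_top hu).lt) ?_
  rw [h]
  exact fun _ _ => (hP'.isTopExtension_top hu').lt

end TopPerm

/-! ### Counting right ascents by position -/

section Ascents

variable {n : ℕ} {z : Perm (Fin n)} {i j : Fin n}

/-- The positions of the right ascents of `z`. -/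
def ascents (z : Perm (Fin n)) : Set (Fin n) :=
  {i | ∃ j : Fin n, (i : ℕ) + 1 = j ∧ z i < z j}

theorem lt_of_forall_ascent (hij : i < j) (h : ∀ m, i ≤ m → m < j → m ∈ ascents z) : z i < z j := by
  induction hd : (j : ℕ) - i generalizing i with
  | zero =>
    rw [Fin.lt_def] at hij
    omega
  | succ d ih =>
    obtain ⟨m, him, hlt⟩ := h i le_rfl hij
    rw [Fin.lt_def] at hij
    by_cases hmj : m = j
    · rwa [← hmj]
    · have hmj' : (m : ℕ) ≠ j := fun h => hmj (Fin.ext h)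
      refine hlt.trans (ih (by rw [Fin.lt_def]; omega) (fun x hx => h x ?_) (by omega))
      refine le_trans ?_ hx
      rw [Fin.le_def]
      omega

theorem asc_eq_ncard_ascents (z : Perm (Fin n)) : asc z = (ascents z).ncard := by
  classical
  let D : Set (Fin n) := {i | ∃ j : Fin n, (i : ℕ) + 1 = j ∧ z j < z i}
  have hD : (rightDescents z).ncard = D.ncard := by
    refine (Set.ncard_congr (fun i (hi : i ∈ D) => swap i hi.choose) ?_ ?_ ?_).symm
    · intro i hi
      exact ⟨⟨i, _, hi.choose_spec.1, rfl⟩,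
        (length_mul_swap_lt_iff hi.choose_spec.1).2 hi.choose_spec.2⟩
    · intro i i' hi hi' h
      have h1 := hi.choose_spec.1
      have h2 := hi'.choose_spec.1
      set j := hi.choose
      set j' := hi'.choose
      have h3 := DFunLike.congr_fun h i
      rw [swap_apply_left, swap_apply_def] at h3
      simp only [Fin.ext_iff] at h3 ⊢
      split_ifs at h3 <;> omega
    · rintro s ⟨⟨i, j, hij, rfl⟩, hs⟩
      have hi : i ∈ D := ⟨j, hij, (length_mul_swap_lt_iff hij).1 hs⟩
      refine ⟨i, hi, ?_⟩
      have h1 := hi.choose_spec.1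
      have : hi.choose = j := Fin.ext (by omega)
      rw [this]
  have hunion : ascents z ∪ D = {i : Fin n | (i : ℕ) + 1 < n} := by
    ext i
    constructor
    · rintro (⟨j, hij, -⟩ | ⟨j, hij, -⟩) <;>
      · have := j.2
        change (i : ℕ) + 1 < n
        omega
    · intro hi
      have hne : z i ≠ z ⟨i + 1, hi⟩ := z.injective.ne fun h => by
        have := congrArg Fin.val h
        simp at this
      rcases lt_or_gt_of_ne hne with h | h
      · exact Or.inl ⟨_, rfl, h⟩
      · exact Or.inr ⟨_, rfl, h⟩
  have hdisj : Disjoint (ascents z) D := by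
    rw [Set.disjoint_left]
    rintro i ⟨j, hij, h⟩ ⟨j', hij', h'⟩
    have : j = j' := Fin.ext (by omega)
    subst this
    exact h.asymm h'
  have hcard : {i : Fin n | (i : ℕ) + 1 < n}.ncard = n - 1 := by
    rcases n with _ | n
    · simp [Set.eq_empty_of_isEmpty]
    · have : {i : Fin (n + 1) | (i : ℕ) + 1 < n + 1} = {Fin.last n}ᶜ := by
        ext i
        simp only [Set.mem_compl_iff, Set.mem_singleton_iff, Fin.ext_iff, Fin.val_last]
        change (i : ℕ) + 1 < n + 1 ↔ _
        have := i.2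
        omega
      rw [this, Set.ncard_compl, Set.ncard_singleton, Nat.card_eq_fintype_card, Fintype.card_fin]
  have := Set.ncard_union_eq hdisj
  rw [hunion, hcard] at this
  rw [asc, hD]
  omega

end Ascents

/-! ### Edges, faces and out-degrees of `Q_w` -/

section BruhatIntervalPolytope

variable {n : ℕ} {u v w z : Perm (Fin n)} {i j p q : Fin n} {P : Fin n → Fin n → Prop}
  {e F : Set (EuclideanSpace ℝ (Fin n))}

theorem isPolytope_bruhatIntervalPolytope (w : Perm (Fin n)) :
    IsPolytope (bruhatIntervalPolytope w) :=
  isPolytope_convexHull ((Set.toFinite _).image _)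

theorem permVec_mem (hu : bruhatLE u w) : permVec u ∈ bruhatIntervalPolytope w :=
  subset_convexHull ℝ _ ⟨u, hu, rfl⟩

theorem IsFace.exists_permVec (hF : IsFace (bruhatIntervalPolytope w) F) :
    ∃ u, bruhatLE u w ∧ permVec u ∈ F := by
  have h := IsFace.eq_convexHull ((Set.toFinite _).image _) hF
  have hne := hF.1
  rw [h, convexHull_nonempty_iff] at hne
  obtain ⟨_, ⟨u, hu, rfl⟩, huF⟩ := hne
  exact ⟨u, hu, huF⟩

theorem IsFace.eq_singleton (hF : IsFace (bruhatIntervalPolytope w) F) (hu : permVec u ∈ F)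
    (h : ∀ v, bruhatLE v w → permVec v ∈ F → v = u) : F = {permVec u} := by
  refine Set.Subset.antisymm ?_ (Set.singleton_subset_iff.2 hu)
  have h1 := IsFace.eq_convexHull ((Set.toFinite _).image _) hF
  rw [h1]
  refine convexHull_min ?_ (convex_singleton _)
  rintro _ ⟨⟨v, hv, rfl⟩, hvF⟩
  rw [h v hv hvF]
  rfl

theorem isVertex_permVec (hu : bruhatLE u w) :
    IsVertex (bruhatIntervalPolytope w) (permVec u) := by
  have hF := isFace_of_functional (innerSL ℝ (permVec u)) (permVec_mem hu) fun y hy => by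
    simp only [innerSL_apply_apply]
    refine (forall_inner_le_iff (permVec u) _).2 (fun v hv => ?_) y hy
    rw [inner_permVec]
    by_cases h : v = u
    · rw [h]
    · exact (pairing_permVec_lt h).le
  have h1 := hF.eq_singleton (u := u) ⟨permVec_mem hu, rfl⟩ fun v hv hvF => by
    by_contra hne
    have h2 := hvF.2
    simp only [innerSL_apply_apply, inner_permVec] at h2
    exact (pairing_permVec_lt hne).ne h2
  rwa [h1] at hF

theorem isVertex_iff {x : EuclideanSpace ℝ (Fin n)} :
    IsVertex (bruhatIntervalPolytope w) x ↔ ∃ u, bruhatLE u w ∧ permVec u = x := by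
  constructor
  · exact fun h => h.mem_of_convexHull
  · rintro ⟨u, hu, rfl⟩
    exact isVertex_permVec hu

theorem FanPoset.swap_mul_ne (h : FanPoset w u P) (hpq : P p q) : swap p q * u ≠ u := by
  intro h1
  rw [mul_eq_right, swap_eq_one_iff] at h1
  subst h1
  exact lt_irrefl _ (h.lt _ _ hpq)

theorem FanPoset.pairing_swap_mul_eq_iff (h : FanPoset w u P) (hpq : P p q) (a : Fin n → ℝ) :
    pairing a (swap p q * u) = pairing a u ↔ a p = a q := by
  have h1 := Fin.lt_def.1 (h.lt _ _ hpq)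
  have h2 : (((u⁻¹ q : Fin n) : ℕ) : ℝ) - (((u⁻¹ p : Fin n) : ℕ) : ℝ) ≠ 0 := by
    rw [sub_ne_zero]
    exact_mod_cast h1.ne'
  rw [pairing_swap_mul, add_eq_left, mul_eq_zero, or_iff_left h2, sub_eq_zero]

/-- An edge at `u` leads to a vertex obtained from a cover relation of the poset of `u`. -/
theorem FanPoset.exists_cover_of_isEdge (h : FanPoset w u P)
    (he : IsEdge (bruhatIntervalPolytope w) e) (hue : permVec u ∈ e) :
    ∃ p q, P p q ∧ (∀ m, ¬ (P p m ∧ P m q)) ∧ bruhatLE (swap p q * u) w ∧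
      permVec (swap p q * u) ∈ e := by
  obtain ⟨l, hl, hle⟩ := he.1.exists_functional_at hue
  obtain ⟨a, rfl⟩ : ∃ a, l = innerSL ℝ a :=
    ⟨(InnerProductSpace.toDual ℝ _).symm l, by
      ext x
      simp [InnerProductSpace.toDual_symm_apply]⟩
  simp only [innerSL_apply_apply] at hl hle
  have hmax : ∀ v, bruhatLE v w → pairing a v ≤ pairing a u := mem_normalCone_iff.1 hl
  have hmono : ∀ p q, P p q → a p ≤ a q := fun p q hpq => h.monotone_of_maximal hmax hpq
  -- If `a` were strictly `P`-monotone it would expose only the vertex `u`, not an edge.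
  have htight : ∃ p q, P p q ∧ a p = a q := by
    by_contra! hc
    have := he.1.eq_singleton hue fun v hv hve => by
      by_contra hne
      have h1 := ((hle _).1 hve).2
      rw [inner_permVec, inner_permVec] at h1
      exact (h.max a (fun p q hpq => lt_of_le_of_ne (hmono p q hpq) (hc p q hpq)) v hv hne).ne h1
    obtain ⟨x, hx, hxne⟩ := he.exists_ne hue
    rw [this] at hx
    exact hxne hx
  -- By monotonicity a tie across `p`, `q` persists on every refinement, so it can be shrunk to a
  -- cover.
  have hcov : ∃ p q, P p q ∧ a p = a q ∧ ∀ m, ¬ (P p m ∧ P m q) := by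
    obtain ⟨p, q, hpq, hapq⟩ := htight
    induction hm : ((u⁻¹ q : Fin n) : ℕ) - (u⁻¹ p : Fin n) using Nat.strong_induction_on
      generalizing p q with
    | _ m ih =>
      by_cases hno : ∀ m, ¬ (P p m ∧ P m q)
      · exact ⟨p, q, hpq, hapq, hno⟩
      push Not at hno
      obtain ⟨r, h1, h2⟩ := hno
      have h3 := Fin.lt_def.1 (h.lt _ _ h1)
      have h4 := Fin.lt_def.1 (h.lt _ _ h2)
      have h5 := hmono _ _ h1
      have h6 := hmono _ _ h2
      exact ih _ (by omega) p r h1 (by linarith) rfl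
  obtain ⟨p, q, hpq, hapq, hno⟩ := hcov
  have hle' := (h.cover _ _ hpq).resolve_left fun ⟨m, hm⟩ => hno m hm
  refine ⟨p, q, hpq, hno, hle', (hle _).2 ⟨permVec_mem hle', ?_⟩⟩
  rw [inner_permVec, inner_permVec]
  exact (h.pairing_swap_mul_eq_iff hpq _).2 hapq

/-- The face at `u` whose normal vector is ordered as `z`, with ties at the positions in `A`. -/
theorem FanPoset.exists_face (h : FanPoset w u P) (hu : bruhatLE u w) (hz : IsTopExtension P z)
    (A : Set (Fin n)) :
    ∃ F, IsFace (bruhatIntervalPolytope w) F ∧ permVec u ∈ F ∧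
      ∀ p q, P p q → bruhatLE (swap p q * u) w →
        (permVec (swap p q * u) ∈ F ↔ ∀ m, z⁻¹ p ≤ m → m < z⁻¹ q → m ∈ A) := by
  classical
  -- `a x = |g x|` counts the positions outside `A` before `x` in `z`. It is a step function along
  -- `z` whose values at positions `m` and `m + 1` agree exactly when `m ∈ A`.
  let g : Fin n → Finset (Fin n) := fun x => Finset.univ.filter fun m => m < z⁻¹ x ∧ m ∉ A
  have hg : ∀ p q, P p q → g p ⊆ g q := by
    intro p q hpq m hm
    simp only [g, Finset.mem_filter, Finset.mem_univ, true_and] at hm ⊢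
    exact ⟨hm.1.trans (hz.lt hpq), hm.2⟩
  let a : EuclideanSpace ℝ (Fin n) := WithLp.toLp 2 fun x => ((g x).card : ℝ)
  have hapq : ∀ p q, P p q → a p ≤ a q := by
    intro p q hpq
    exact Nat.cast_le.2 (Finset.card_le_card (hg p q hpq))
  have heq : ∀ p q, P p q → (a p = a q ↔ ∀ m, z⁻¹ p ≤ m → m < z⁻¹ q → m ∈ A) := by
    intro p q hpq
    change ((g p).card : ℝ) = ((g q).card : ℝ) ↔ _
    rw [Nat.cast_inj]
    constructor
    · intro hc m h1 h2
      by_contra hm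
      have h3 := Finset.eq_of_subset_of_card_le (hg p q hpq) hc.ge
      have h4 : m ∈ g p := by
        rw [h3]
        simp [g, hm]
        exact h2
      simp only [g, Finset.mem_filter] at h4
      exact h4.2.1.not_ge h1
    · intro hA
      congr 1
      refine (hg p q hpq).antisymm fun m hm => ?_
      simp only [g, Finset.mem_filter, Finset.mem_univ, true_and] at hm ⊢
      exact ⟨not_le.1 fun h1 => hm.2 (hA m h1 hm.1), hm.2⟩
  have hF := isFace_of_functional (innerSL ℝ a) (permVec_mem hu)
    (mem_normalCone_iff.2 fun v hv => h.maximal_of_monotone hapq hv)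
  refine ⟨_, hF, ⟨permVec_mem hu, rfl⟩, fun p q hpq hle => ?_⟩
  rw [← heq p q hpq, ← h.pairing_swap_mul_eq_iff hpq, ← inner_permVec, ← inner_permVec]
  exact ⟨fun h => h.2, fun h => ⟨permVec_mem hle, h⟩⟩

/-- The edges at `u` of the face attached to a set of ascents. -/
theorem FanPoset.edge_subset_face_iff (h : FanPoset w u P) (hz : IsTopExtension P z)
    {A : Set (Fin n)} (hA : A ⊆ ascents z) (hF : IsFace (bruhatIntervalPolytope w) F)
    (huF : permVec u ∈ F) (hFA : ∀ p q, P p q → bruhatLE (swap p q * u) w →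
      (permVec (swap p q * u) ∈ F ↔ ∀ m, z⁻¹ p ≤ m → m < z⁻¹ q → m ∈ A))
    (he : IsEdge (bruhatIntervalPolytope w) e) (hue : permVec u ∈ e) :
    e ⊆ F ↔ ∃ i ∈ A, ∃ j : Fin n, (i : ℕ) + 1 = j ∧ permVec (swap (z i) (z j) * u) ∈ e := by
  constructor
  · intro heF
    obtain ⟨p, q, hpq, hno, hle, hmem⟩ := h.exists_cover_of_isEdge he hue
    have h1 := (hFA p q hpq hle).1 (heF hmem)
    have h2 := hz.lt hpq
    -- A tie from `p` to `q` passes only through ascents of `z`, so `p < q`, and such a cover sits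
    -- at a single ascent.
    have h3 : p < q := by
      simpa using lt_of_forall_ascent h2 fun m hm hm' => hA (h1 m hm hm')
    obtain ⟨i, j, hij, rfl, rfl⟩ := hz.exists_ascent h hpq h3 hno
    rw [← Perm.mul_apply, ← Perm.mul_apply, inv_mul_cancel, Perm.one_apply, Perm.one_apply] at h1 h2
    exact ⟨i, h1 i le_rfl h2, j, hij, hmem⟩
  · rintro ⟨i, hi, j, hij, hmem⟩
    obtain ⟨j', hij', hlt⟩ := hA hi
    obtain rfl : j = j' := Fin.ext (by omega)
    have hP := hz.rel_of_ascent hij hlt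
    have hle := hz.bruhatLE_of_ascent h hij hlt
    refine he.subset_face hF hue hmem (permVec_injective.ne (h.swap_mul_ne hP)) huF ?_
    refine (hFA _ _ hP hle).2 fun m h1 h2 => ?_
    rw [← Perm.mul_apply, inv_mul_cancel, Perm.one_apply] at h1 h2
    have : m = i := by
      rw [Fin.le_def] at h1
      rw [Fin.lt_def] at h2
      exact Fin.ext (by omega)
    rwa [this]

/-- The cost is `-(1, …, n)`, so moving to `(p q)u` raises it exactly when the swap creates an
inversion, that is, goes up in Bruhat order. -/
theorem inner_neg_permVec_one_lt_iff (hpq : u⁻¹ p < u⁻¹ q) :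
    inner ℝ (-permVec 1) (permVec u) < inner ℝ (-permVec 1) (permVec (swap p q * u)) ↔ p < q := by
  rw [inner_permVec, inner_permVec, pairing_swap_mul, lt_add_iff_pos_right]
  have h1 : (((u⁻¹ p : Fin n) : ℕ) : ℝ) < (((u⁻¹ q : Fin n) : ℕ) : ℝ) := by
    exact_mod_cast Fin.lt_def.1 hpq
  rw [mul_pos_iff_of_pos_right (sub_pos.2 h1), PiLp.neg_apply, PiLp.neg_apply, permVec_apply,
    permVec_apply, Fin.lt_def, ← Nat.cast_lt (α := ℝ)]
  simp only [inv_one, Perm.one_apply]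
  constructor <;> intro h <;> linarith

theorem FanPoset.mem_outEdges_iff (h : FanPoset w u P) (hu : bruhatLE u w)
    (hz : IsTopExtension P z) :
    e ∈ outEdges (bruhatIntervalPolytope w) (-permVec 1) (permVec u) ↔
      IsEdge (bruhatIntervalPolytope w) e ∧ permVec u ∈ e ∧
        ∃ i ∈ ascents z, ∃ j : Fin n, (i : ℕ) + 1 = j ∧ permVec (swap (z i) (z j) * u) ∈ e := by
  constructor
  · rintro ⟨he, hue, hout⟩
    refine ⟨he, hue, ?_⟩
    obtain ⟨p, q, hpq, hno, hle, hmem⟩ := h.exists_cover_of_isEdge he hue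
    have h1 := (inner_neg_permVec_one_lt_iff (h.lt _ _ hpq)).1
      (hout _ hmem (permVec_injective.ne (h.swap_mul_ne hpq)))
    obtain ⟨i, j, hij, rfl, rfl⟩ := hz.exists_ascent h hpq h1 hno
    exact ⟨i, ⟨j, hij, h1⟩, j, hij, hmem⟩
  · rintro ⟨he, hue, i, ⟨j', hij', hlt⟩, j, hij, hmem⟩
    obtain rfl : j = j' := Fin.ext (by omega)
    have hP := hz.rel_of_ascent hij hlt
    refine ⟨he, hue, fun x hx hne => ?_⟩
    have hsu := permVec_injective.ne (h.swap_mul_ne hP)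
    obtain ⟨t, ht⟩ := he.exists_smul hue hmem hsu hx
    -- A functional with strict maximum at the vertex forces `t > 0`: all of the edge lies on the
    -- same side of `permVec u`.
    obtain ⟨l, hl⟩ := (isVertex_permVec hu).exists_functional
    have h1 := hl x (he.1.subset hx) hne
    have h2 := hl _ (he.1.subset hmem) hsu
    have h3 : l (x - permVec u) = t * l (permVec (swap (z i) (z j) * u) - permVec u) := by
      rw [ht, map_smul, smul_eq_mul]
    rw [map_sub, map_sub] at h3
    have ht0 : 0 < t := by
      by_contra h4
      nlinarith
    have h4 := (inner_neg_permVec_one_lt_iff (h.lt _ _ hP)).2 hlt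
    rw [← sub_pos, ← inner_sub_right, ht, inner_smul_right, inner_sub_right]
    exact mul_pos ht0 (sub_pos.2 h4)

theorem isGeneric_neg_permVec_one (w : Perm (Fin n)) :
    IsGeneric (bruhatIntervalPolytope w) (-permVec 1) := by
  intro e he
  obtain ⟨u, hu, hue⟩ := he.1.exists_permVec
  obtain ⟨P, hP⟩ := exists_fanPoset_of_bruhatLE hu
  obtain ⟨p, q, hpq, -, -, hmem⟩ := hP.exists_cover_of_isEdge he hue
  refine ⟨_, hue, _, hmem, ?_⟩
  rw [inner_sub_right, sub_ne_zero, inner_permVec, inner_permVec, Ne,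
    hP.pairing_swap_mul_eq_iff hpq, PiLp.neg_apply, PiLp.neg_apply, neg_inj, permVec_apply,
    permVec_apply, add_left_inj, Nat.cast_inj]
  simp only [inv_one, Perm.one_apply]
  intro h
  obtain rfl := Fin.ext h
  exact lt_irrefl _ (hP.lt _ _ hpq)

theorem isDirectionallySimple_bruhatIntervalPolytope (w : Perm (Fin n)) :
    IsDirectionallySimple (bruhatIntervalPolytope w) (-permVec 1) := by
  intro v hv E hE
  obtain ⟨u, hu, rfl⟩ := isVertex_iff.1 hv
  obtain ⟨P, hP⟩ := exists_fanPoset_of_bruhatLE hu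
  have hz := hP.isTopExtension_top hu
  set z := Top w u
  -- The ascents whose neighbouring vertex lies on one of the prescribed edges.
  let A : Set (Fin n) := {i | i ∈ ascents z ∧ ∃ j : Fin n, (i : ℕ) + 1 = j ∧
    ∃ e ∈ E, permVec (swap (z i) (z j) * u) ∈ e}
  obtain ⟨F, hF, huF, hFA⟩ := hP.exists_face hu hz A
  refine ⟨F, hF, huF, ?_⟩
  ext e
  constructor
  · rintro ⟨he, hue, heF⟩
    obtain ⟨i, hiA, j, hij, hmem⟩ :=
      (hP.edge_subset_face_iff hz (fun _ hi => hi.1) hF huF hFA he hue).1 heF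
    obtain ⟨⟨j', hij', hlt⟩, j'', hij'', e', he', hmem'⟩ := hiA
    obtain rfl : j = j' := Fin.ext (by omega)
    obtain rfl : j = j'' := Fin.ext (by omega)
    have hne := permVec_injective.ne (hP.swap_mul_ne (hz.rel_of_ascent hij hlt))
    rwa [he.eq_of_mem (hE he').1 hue hmem hne (hE he').2.1 hmem']
  · intro he
    obtain ⟨he1, hue, i, hi, j, hij, hmem⟩ := (hP.mem_outEdges_iff hu hz).1 (hE he)
    refine ⟨he1, hue, ?_⟩
    rw [hP.edge_subset_face_iff hz (fun _ hi => hi.1) hF huF hFA he1 hue]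
    exact ⟨i, ⟨hi, j, hij, e, he, hmem⟩, j, hij, hmem⟩

theorem ncard_outEdges_permVec (hu : bruhatLE u w) :
    (outEdges (bruhatIntervalPolytope w) (-permVec 1) (permVec u)).ncard = asc (Top w u) := by
  obtain ⟨P, hP⟩ := exists_fanPoset_of_bruhatLE hu
  have hz := hP.isTopExtension_top hu
  set z := Top w u
  have hQ := isPolytope_bruhatIntervalPolytope w
  rw [asc_eq_ncard_ascents]
  -- With ties at the single ascent `i`, the face contains the neighbour of `i` and of no other
  -- ascent. Every edge of this face at `u` contains that neighbour, so it is the out-edge attached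
  -- to `i`.
  have hface : ∀ i ∈ ascents z, ∃ F, IsFace (bruhatIntervalPolytope w) F ∧ permVec u ∈ F ∧
      ∀ i' j' : Fin n, i' ∈ ascents z → (i' : ℕ) + 1 = j' →
        (permVec (swap (z i') (z j') * u) ∈ F ↔ i' = i) ∧
        ∀ e, IsEdge (bruhatIntervalPolytope w) e → permVec u ∈ e → e ⊆ F → i' = i →
          permVec (swap (z i') (z j') * u) ∈ e := by
    intro i hi
    obtain ⟨F, hF, huF, hFA⟩ := hP.exists_face hu hz {i}
    refine ⟨F, hF, huF, fun i' j' hi' hij' => ⟨?_, fun e he hue heF h => ?_⟩⟩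
    · obtain ⟨j'', hij'', hlt⟩ := hi'
      obtain rfl : j' = j'' := Fin.ext (by omega)
      rw [hFA _ _ (hz.rel_of_ascent hij' hlt) (hz.bruhatLE_of_ascent hP hij' hlt)]
      rw [← Perm.mul_apply, ← Perm.mul_apply, inv_mul_cancel, Perm.one_apply, Perm.one_apply]
      constructor
      · intro h
        exact h i' le_rfl (by rw [Fin.lt_def]; omega)
      · rintro rfl m h1 h2
        rw [Fin.le_def] at h1
        rw [Fin.lt_def] at h2
        exact Fin.ext (by omega)
    · obtain ⟨i'', rfl, j'', hij'', hmem⟩ := (hP.edge_subset_face_iff hz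
        (Set.singleton_subset_iff.2 hi) hF huF hFA he hue).1 heF
      subst h
      obtain rfl : j' = j'' := Fin.ext (by omega)
      exact hmem
  have hedge : ∀ i ∈ ascents z, ∃ e, IsEdge (bruhatIntervalPolytope w) e ∧ permVec u ∈ e ∧
      ∀ i' j' : Fin n, i' ∈ ascents z → (i' : ℕ) + 1 = j' →
        (permVec (swap (z i') (z j') * u) ∈ e ↔ i' = i) := by
    intro i hi
    obtain ⟨F, hF, huF, h⟩ := hface i hi
    obtain ⟨j, hij, hlt⟩ := id hi
    have hne := permVec_injective.ne (hP.swap_mul_ne (hz.rel_of_ascent hij hlt))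
    obtain ⟨e, he, hue, heF⟩ := hF.exists_edge hQ (isVertex_permVec hu) huF
      ((h i j hi hij).1.2 rfl) hne
    refine ⟨e, he, hue, fun i' j' hi' hij' => ⟨fun h1 => (h i' j' hi' hij').1.1 (heF h1), ?_⟩⟩
    exact (h i' j' hi' hij').2 e he hue heF
  choose! f hfe hfu hf using hedge
  have himage : outEdges (bruhatIntervalPolytope w) (-permVec 1) (permVec u) = f '' ascents z := by
    ext e
    rw [hP.mem_outEdges_iff hu hz]
    constructor
    · rintro ⟨he, hue, i, hi, j, hij, hmem⟩
      refine ⟨i, hi, ?_⟩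
      obtain ⟨j', hij', hlt⟩ := id hi
      obtain rfl : j = j' := Fin.ext (by omega)
      have hne := permVec_injective.ne (hP.swap_mul_ne (hz.rel_of_ascent hij hlt))
      exact (hfe i hi).eq_of_mem he (hfu i hi) ((hf i hi i j hi hij).2 rfl) hne hue hmem
    · rintro ⟨i, hi, rfl⟩
      obtain ⟨j, hij, -⟩ := id hi
      exact ⟨hfe i hi, hfu i hi, i, hi, j, hij, (hf i hi i j hi hij).2 rfl⟩
  refine himage ▸ Set.InjOn.ncard_image ?_
  intro i hi i' hi' h
  obtain ⟨j, hij, -⟩ := id hi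
  exact (hf i' hi' i j hi hij).1 (h ▸ (hf i hi i j hi hij).2 rfl)

theorem hVector_bruhatIntervalPolytope (w : Perm (Fin n)) (k : ℕ) :
    hVector (bruhatIntervalPolytope w) k =
      (({z | z ∈ Top w '' lowerInterval w ∧ asc z = k}.ncard : ℕ) : ℤ) := by
  rw [hVector_eq_ncard (isPolytope_bruhatIntervalPolytope w) (isGeneric_neg_permVec_one w)
    (isDirectionallySimple_bruhatIntervalPolytope w)]
  have h1 : {v | IsVertex (bruhatIntervalPolytope w) v ∧
      (outEdges (bruhatIntervalPolytope w) (-permVec 1) v).ncard = k} =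
      permVec '' {u | u ∈ lowerInterval w ∧ asc (Top w u) = k} := by
    ext x
    constructor
    · rintro ⟨hx, hk⟩
      obtain ⟨u, hu, rfl⟩ := isVertex_iff.1 hx
      exact ⟨u, ⟨hu, by rwa [← ncard_outEdges_permVec hu]⟩, rfl⟩
    · rintro ⟨u, ⟨hu, hk⟩, rfl⟩
      exact ⟨isVertex_permVec hu, by rwa [ncard_outEdges_permVec hu]⟩
  have h2 : {z | z ∈ Top w '' lowerInterval w ∧ asc z = k} =
      Top w '' {u | u ∈ lowerInterval w ∧ asc (Top w u) = k} := by
    ext z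
    constructor
    · rintro ⟨⟨u, hu, rfl⟩, hk⟩
      exact ⟨u, ⟨hu, hk⟩, rfl⟩
    · rintro ⟨u, ⟨hu, hk⟩, rfl⟩
      exact ⟨⟨u, hu, rfl⟩, hk⟩
  rw [h1, h2, Set.ncard_image_of_injective _ permVec_injective,
    ((top_injOn w).mono fun _ hu => hu.1).ncard_image]

end BruhatIntervalPolytope

end BruhatPolytope

/-- First part: the `h`-vector of a directionally simple polytope counts vertices by out-degree.
Second part: `Top_w` is well defined, and the `h`-vector of `Q_w` counts the elements of
`Top_w([e, w])` by number of right ascents. -/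
theorem mainTheorem9 :
    (∀ (d : ℕ) (Q : Set (EuclideanSpace ℝ (Fin d))) (c : EuclideanSpace ℝ (Fin d)),
      BruhatPolytope.IsPolytope Q → BruhatPolytope.IsGeneric Q c →
      BruhatPolytope.IsDirectionallySimple Q c →
      ∀ k ≤ d, BruhatPolytope.hVector Q k =
        (({v | BruhatPolytope.IsVertex Q v ∧
          (BruhatPolytope.outEdges Q c v).ncard = k}.ncard : ℕ) : ℤ)) ∧
    (∀ (n : ℕ) (w : Equiv.Perm (Fin n)),
      (∀ x, BruhatPolytope.IsTop w x (BruhatPolytope.Top w x)) ∧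
      ∀ k : ℕ, BruhatPolytope.hVector (BruhatPolytope.bruhatIntervalPolytope w) k =
        (({z | z ∈ BruhatPolytope.Top w '' BruhatPolytope.lowerInterval w ∧
          BruhatPolytope.asc z = k}.ncard : ℕ) : ℤ)) :=
    ⟨fun _ _ _ hQ hc hds k _ => BruhatPolytope.hVector_eq_ncard hQ hc hds k,
      fun _ w => ⟨BruhatPolytope.isTop_top w, BruhatPolytope.hVector_bruhatIntervalPolytope w⟩⟩
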